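/- Throughout, partial maps are composed from left to right ($ab$ means first $a$, then $b$). For a semigroup $H$ put $a\,\mathcal R\,b \iff aH^1=bH^1$ and $a\,\mathcal L\,b\iff H^1a=H^1b$. For $\mathcal G\in\{\mathcal R,\mathcal L\}$, a *$\mathcal G$-cross-section* of $H$ is a subsemigroup containing exactly one element of every $\mathcal G$-class. Let $\mathcal{IS}(X)$ be the semigroup of all partial bijections of a set $X$, and $\mathcal{IS}_n=\mathcal{IS}(\{1,\dots,n\})$. For a semigroup $S$ and a subsemigroup $P\subseteq \mathcal{IS}(X)$, the *partial wreath product* $S\wr_p P$ is the set of pairs $(f,a)$ where $a\in P$ and $f$ is a partial function from $X$ to $S$ with $\operatorname{dom} f=\operatorname{dom} a$, with multiplication $(f,a)(g,b)=(fg^a,ab)$, where $(fg^a)(x)=f(x)\,g(xa)$ for $x\in\operatorname{dom}(ab)$. Let $\{1,\dots,n\}=M_1\sqcup\dots\sqcup M_k$ be a decomposition into non-empty blocks, each with a linear order $M_i=\{m^i_1<\dots<m^i_{|M_i|}\}$. Let $a_{i,j}$ be the partial bijection with $m^i_l\mapsto m^i_{l+1}$ for $l<j$, undefined at $m^i_j$,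 and fixing every other point. Let $R(M_1,\dots,M_k)\subseteq\mathcal{IS}_n$ be the subsemigroup generated by all $a_{i,j}$ and the identity, and let $R(M_i)\subseteq \mathcal{IS}(M_i)$ be the same for the single ordered block $M_i$. Put $L(M_1,\dots,M_k)=\{a^{-1}: a\in R(M_1,\dots,M_k)\}$ and $L(M_i)=\{a^{-1}: a\in R(M_i)\}$. Identify $\prod_i \bigl(S\wr_p\mathcal{IS}(M_i)\bigr)$ with the subsemigroup of $S\wr_p\mathcal{IS}_n$ of those $(f,a)$ for which $a$ maps $M_i\cap\operatorname{dom}a$ into $M_i$ for every $i$, by restricting $f$ and $a$ to the blocks. Let $T_n^k$ be the $n$-regular rooted tree with $k$ levels below the root, and let $\mathrm{PAut}\,T_n^k$ be the semigroup of its partial automorphisms, that is, of the injective, adjacency-preserving partial maps on vertices that fix the root and whose domain is a connected subtree containing the root. **Statement.** Let $n\ge 0$. The following hold for $\mathcal R$-cross-sections, and also for $\mathcal L$-cross-sections with every $R(\cdot)$ replaced by $L(\cdot)$. 1. For every ordered decomposition as above and all $\mathcal R$-cross-sections $R_1,\dots,R_k$ of $\mathcal{IS}_n$, the product $$(R_1\wr_p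 R(M_1))\times\dots\times(R_k\wr_p R(M_k))$$ is an $\mathcal R$-cross-section of $\mathcal{IS}_n\wr_p\mathcal{IS}_n$. Conversely, every $\mathcal R$-cross-section of $\mathcal{IS}_n\wr_p\mathcal{IS}_n$ is isomorphic to such a product, for some ordered decomposition and some $\mathcal R$-cross-sections $R_i$ of $\mathcal{IS}_n$. 2. Let $W_1=\mathcal{IS}_n$ and $W_{k+1}=W_k\wr_p\mathcal{IS}_n$. For all $k\ge1$, $\mathrm{PAut}\,T_n^k\cong W_k$ and $\mathrm{PAut}\,T_n^{k+1}\cong \mathrm{PAut}\,T_n^k\wr_p\mathcal{IS}_n$. For every isomorphism of the latter kind, every ordered decomposition with blocks $M_1,\dots,M_r$ and all $\mathcal R$-cross-sections $R_1,\dots,R_r$ of $\mathrm{PAut}\,T_n^k$, the product $\prod_i (R_i\wr_p R(M_i))$ corresponds to an $\mathcal R$-cross-section of $\mathrm{PAut}\,T_n^{k+1}$, and every $\mathcal R$-cross-section of $\mathrm{PAut}\,T_n^{k+1}$ is isomorphic to such a product. 3. Define the *iterated products* in $W_k$ recursively: those in $W_1$ are the semigroups $R(M_1,\dots,M_r)$,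 and those in $W_{k+1}$ are the semigroups $\prod_i (R_i\wr_p R(M_i))$ with $R_i$ iterated products in $W_k$ (over all ordered decompositions of $\{1,\dots,n\}$). Then for all $k\ge1$ and every isomorphism $\mathrm{PAut}\,T_n^k\cong W_k$, every iterated product in $W_k$ corresponds to an $\mathcal R$-cross-section of $\mathrm{PAut}\,T_n^k$, and every $\mathcal R$-cross-section of $\mathrm{PAut}\,T_n^k$ is isomorphic, as a semigroup, to an iterated product in $W_k$. -/

import Mathlib

/-! ### Green's relations and cross-sections -/

/-- The two Green's relations that are considered. -/
inductive Green where
  | R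
  | L

/-- `a H¹`, the principal right ideal generated by `a`. -/
def rightIdeal {H : Type*} [Semigroup H] (a : H) : Set H := {x | x = a ∨ ∃ h, x = a * h}

/-- `H¹ a`, the principal left ideal generated by `a`. -/
def leftIdeal {H : Type*} [Semigroup H] (a : H) : Set H := {x | x = a ∨ ∃ h, x = h * a}

/-- Green's relations: `a R b ↔ a H¹ = b H¹` and `a L b ↔ H¹ a = H¹ b`. -/
def Green.rel {H : Type*} [Semigroup H] : Green → H → H → Prop
  | .R, a, b => rightIdeal a = rightIdeal b
  | .L, a, b => leftIdeal a = leftIdeal b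

/-- A subsemigroup containing exactly one element of every class of the Green's relation `g`. -/
def IsCrossSection {H : Type*} [Semigroup H] (g : Green) (T : Subsemigroup H) : Prop :=
  ∀ h : H, ∃! t : H, t ∈ T ∧ g.rel t h

/-! ### The symmetric inverse semigroup -/

/-- The semigroup of all partial bijections of `X`. -/
abbrev IS (X : Type*) := X ≃. X

/-- Partial bijections act on the right: `a * b` is first `a`, then `b`. -/
instance IS.instMonoid {X : Type*} : Monoid (IS X) where
  mul a b := a.trans b
  mul_assoc a b c := PEquiv.trans_assoc a b c
  one := PEquiv.refl X
  one_mul a := PEquiv.refl_trans a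
  mul_one a := PEquiv.trans_refl a

theorem IS.mul_apply {X : Type*} (a b : IS X) (x : X) : (a * b) x = (a x).bind b := rfl

/-! ### The partial wreath product -/

/-- The partial wreath product of `S` with the semigroup `IS X` of all partial bijections of `X`:
pairs `(f, a)` of a partial function `f` from `X` to `S` and a partial bijection `a` of `X`
such that `dom f = dom a`. -/
@[ext]
structure PWr (S X : Type*) where
  f : X → Option S
  a : IS X
  dom : ∀ x, (f x).isSome = (a x).isSome

/-- `(f, a) (g, b) = (f g^a, a b)`, where `(f g^a)(x) = f(x) g(xa)` with domain
`{x ∈ dom f ∩ dom a | xa ∈ dom g}`. -/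
instance PWr.instMul {S X : Type*} [Semigroup S] : Mul (PWr S X) where
  mul u v :=
    { f := fun x => (u.f x).bind fun s => (u.a x).bind fun y => (v.f y).map fun t => s * t
      a := u.a * v.a
      dom := by
        intro x
        have h := u.dom x
        rw [IS.mul_apply]
        cases hf : u.f x <;> cases ha : u.a x <;> simp_all [v.dom] }

theorem PWr.mul_f {S X : Type*} [Semigroup S] (u v : PWr S X) (x : X) :
    (u * v).f x =
      (u.f x).bind fun s => (u.a x).bind fun y => (v.f y).map fun t => s * t := rfl

theorem PWr.mul_a {S X : Type*} [Semigroup S] (u v : PWr S X) : (u * v).a = u.a * v.a := rfl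

instance PWr.instSemigroup {S X : Type*} [Semigroup S] : Semigroup (PWr S X) where
  mul_assoc u v w := by
    refine PWr.ext ?_ (mul_assoc u.a v.a w.a)
    · funext x
      simp only [PWr.mul_f, PWr.mul_a, IS.mul_apply]
      cases u.f x with
      | none => rfl
      | some s =>
        cases u.a x with
        | none => rfl
        | some y =>
          simp only [Option.bind_some]
          cases v.f y with
          | none => rfl
          | some t =>
            simp only [Option.map_some, Option.bind_some]
            cases v.a y with
            | none => rfl
            | some z => cases w.f z <;> simp [mul_assoc]

/-- The partial wreath product of a subsemigroup `T` of `S` with a subsemigroup `P` of `IS X`,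
as a subsemigroup of the partial wreath product of `S` with `IS X`. -/
def pwr {S X : Type*} [Semigroup S] (T : Subsemigroup S) (P : Subsemigroup (IS X)) :
    Subsemigroup (PWr S X) where
  carrier := {u | (∀ x, ∀ s ∈ u.f x, s ∈ T) ∧ u.a ∈ P}
  mul_mem' := by
    rintro u v ⟨hu, hu'⟩ ⟨hv, hv'⟩
    refine ⟨fun x s hs => ?_, P.mul_mem hu' hv'⟩
    rw [PWr.mul_f] at hs
    simp only [Option.mem_def, Option.bind_eq_some_iff, Option.map_eq_some_iff] at hs
    obtain ⟨p, hp, y, -, t, ht, rfl⟩ := hs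
    exact T.mul_mem (hu x p hp) (hv y t ht)

/-! ### Ordered decompositions and the semigroups `R(M₁, …, M_k)` -/

/-- The chain `[0, 1, …, j]` on `{0 < 1 < … < r - 1}`: `x ↦ x + 1` for `x < j`, undefined at `j`,
and `x ↦ x` for `x > j`. -/
def chain {r : ℕ} (j : Fin r) : IS (Fin r) :=
  PEquiv.ofSet {x | x ≠ j} * (Fin.cycleRange j).toPEquiv

/-- The inverses of the elements of a subsemigroup of `IS X`. -/
def invSubsemigroup {X : Type*} (P : Subsemigroup (IS X)) : Subsemigroup (IS X) where
  carrier := {a | a.symm ∈ P}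
  mul_mem' := by
    intro a b ha hb
    change (PEquiv.trans a b).symm ∈ P
    rw [PEquiv.symm_trans_rev]
    exact P.mul_mem hb ha

/-- For the chain `M = {0 < 1 < … < r - 1}`: the semigroup `R(M)`, generated by the chains
`[0, …, j]` and the identity, and its dual `L(M) = R(M)⁻¹`. -/
def chainSection (r : ℕ) : Green → Subsemigroup (IS (Fin r))
  | .R => Subsemigroup.closure (insert 1 (Set.range chain))
  | .L => invSubsemigroup (Subsemigroup.closure (insert 1 (Set.range chain)))

/-- The partial bijection of the disjoint union of the sets `M i` that maps every `M i` into
itself and acts on it as `a i`. -/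
def sigmaIS {ι : Type*} {M : ι → Type*} (a : ∀ i, IS (M i)) : IS (Σ i, M i) where
  toFun x := (a x.1 x.2).map (Sigma.mk x.1)
  invFun y := ((a y.1).symm y.2).map (Sigma.mk y.1)
  inv := by
    rintro ⟨i, p⟩ ⟨j, q⟩
    simp only [Option.map_eq_some_iff, Sigma.mk.injEq]
    constructor
    · rintro ⟨p', h, rfl, h'⟩
      cases h'
      exact ⟨q, (PEquiv.eq_some_iff _).1 h, rfl, HEq.rfl⟩
    · rintro ⟨q', h, rfl, h'⟩
      cases h'
      exact ⟨p, (PEquiv.eq_some_iff _).2 h, rfl, HEq.rfl⟩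

/-- A decomposition of an `n`-element set into `k` disjoint non-empty blocks
`M i = {elt ⟨i, 0⟩ < elt ⟨i, 1⟩ < … < elt ⟨i, size i - 1⟩}`, each linearly ordered. -/
structure OrderedDecomposition (n : ℕ) where
  k : ℕ
  size : Fin k → ℕ
  size_pos : ∀ i, 0 < size i
  elt : (Σ i, Fin (size i)) ≃ Fin n

namespace OrderedDecomposition

variable {n : ℕ} (D : OrderedDecomposition n)

/-- The partial bijection of the `n`-element set that preserves every block and acts on the block
`M i` as `a i` does. -/
def glue (a : ∀ i, IS (Fin (D.size i))) : IS (Fin n) :=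
  (D.elt.symm.toPEquiv.trans (sigmaIS a)).trans D.elt.toPEquiv

theorem glue_elt (a : ∀ i, IS (Fin (D.size i))) (i : Fin D.k) (p : Fin (D.size i)) :
    D.glue a (D.elt ⟨i, p⟩) = (a i p).map fun j => D.elt ⟨i, j⟩ := by
  change (sigmaIS a (D.elt.symm (D.elt ⟨i, p⟩))).bind D.elt.toPEquiv = _
  rw [Equiv.symm_apply_apply]
  change ((a i p).map (Sigma.mk i)).bind D.elt.toPEquiv = _
  cases a i p <;> rfl

theorem glue_mul (a b : ∀ i, IS (Fin (D.size i))) :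
    D.glue (fun i => a i * b i) = D.glue a * D.glue b := by
  refine PEquiv.ext fun x => ?_
  obtain ⟨⟨i, p⟩, rfl⟩ := D.elt.surjective x
  rw [IS.mul_apply, glue_elt, glue_elt, IS.mul_apply]
  cases a i p with
  | none => rfl
  | some q => simp [glue_elt]

/-- The identification of `∏ i, S ≀ IS (M i)` with a subsemigroup of `S ≀ IS n`: a tuple goes to
the pair `(f, a)` whose restrictions to the blocks are the entries of the tuple. -/
def glueHom (S : Type*) [Semigroup S] :
    (∀ i, PWr S (Fin (D.size i))) →ₙ* PWr S (Fin n) where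
  toFun u :=
    { f := fun x => (u (D.elt.symm x).1).f (D.elt.symm x).2
      a := D.glue fun i => (u i).a
      dom := by
        intro x
        obtain ⟨⟨i, p⟩, rfl⟩ := D.elt.surjective x
        rw [glue_elt, Equiv.symm_apply_apply, Option.isSome_map]
        exact (u i).dom p }
  map_mul' u v := by
    refine PWr.ext ?_ (D.glue_mul (fun i => (u i).a) (fun i => (v i).a))
    funext x
    obtain ⟨⟨i, p⟩, rfl⟩ := D.elt.surjective x
    have hf : ∀ (w : ∀ i, PWr S (Fin (D.size i))) (i : Fin D.k) (p : Fin (D.size i)),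
        (w (D.elt.symm (D.elt ⟨i, p⟩)).1).f (D.elt.symm (D.elt ⟨i, p⟩)).2 = (w i).f p := by
      intro w i p
      rw [Equiv.symm_apply_apply]
    change ((u * v) (D.elt.symm (D.elt ⟨i, p⟩)).1).f (D.elt.symm (D.elt ⟨i, p⟩)).2 =
      ((u (D.elt.symm (D.elt ⟨i, p⟩)).1).f (D.elt.symm (D.elt ⟨i, p⟩)).2).bind fun s =>
        (D.glue (fun i => (u i).a) (D.elt ⟨i, p⟩)).bind fun y =>
          ((v (D.elt.symm y).1).f (D.elt.symm y).2).map fun t => s * t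
    rw [hf (u * v), hf u, glue_elt, Pi.mul_apply, PWr.mul_f]
    cases (u i).f p with
    | none => rfl
    | some s => cases (u i).a p <;> simp [hf]

/-- For `g = R` and subsemigroups `T i` of `S`, the direct product
`(T 1 ≀ R(M 1)) × … × (T k ≀ R(M k))`; for `g = L`, the same with `L(M i)`. -/
abbrev Product {S : Type*} [Semigroup S] (g : Green) (T : Fin D.k → Subsemigroup S) : Type _ :=
  ∀ i, pwr (T i) (chainSection (D.size i) g)

/-- The direct product `D.Product g T` realised inside `S ≀ IS n`. -/
def productHom {S : Type*} [Semigroup S] (g : Green) (T : Fin D.k → Subsemigroup S) :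
    D.Product g T →ₙ* PWr S (Fin n) where
  toFun u := D.glueHom S fun i => (u i : PWr S (Fin (D.size i)))
  map_mul' u v := (D.glueHom S).map_mul (fun i => (u i : PWr S _)) (fun i => (v i : PWr S _))

/-- The element `a_{i,j}` of `IS n`: the chain `[elt ⟨i, 0⟩, …, elt ⟨i, j⟩]` of the block `M i`,
which acts as the identity elsewhere. -/
def blockChain (p : Σ i, Fin (D.size i)) : IS (Fin n) :=
  D.glue (Function.update 1 p.1 (chain p.2))

/-- The semigroup `R(M 1, …, M k)`, generated by the `a_{i,j}` and the identity, and its dual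
`L(M 1, …, M k) = R(M 1, …, M k)⁻¹`. -/
def symmSection : Green → Subsemigroup (IS (Fin n))
  | .R => Subsemigroup.closure (insert 1 (Set.range D.blockChain))
  | .L => invSubsemigroup (Subsemigroup.closure (insert 1 (Set.range D.blockChain)))

end OrderedDecomposition

/-! ### Iterated partial wreath products -/

/-- `IterWr n k` is the partial wreath product `IS n ≀ ⋯ ≀ IS n` with `k + 1` factors. -/
def IterWr (n : ℕ) : ℕ → Type
  | 0 => IS (Fin n)
  | k + 1 => PWr (IterWr n k) (Fin n)

instance IterWr.instSemigroup (n : ℕ) : ∀ k, Semigroup (IterWr n k)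
  | 0 => inferInstanceAs (Semigroup (IS (Fin n)))
  | k + 1 =>
    letI := IterWr.instSemigroup n k
    inferInstanceAs (Semigroup (PWr (IterWr n k) (Fin n)))

/-- The data of an iterated product: an ordered decomposition of the `n`-element set and, above
the lowest level, for each of its blocks such data for one level less. -/
def IterData (n : ℕ) : ℕ → Type
  | 0 => OrderedDecomposition n
  | k + 1 => Σ D : OrderedDecomposition n, Fin D.k → IterData n k

/-- The iterated products: `R(M 1, …, M k)` at the lowest level, and at every further level
`(T 1 ≀ R(M 1)) × … × (T k ≀ R(M k))` with iterated products `T i` of the level below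
(for `g = L`, the same with `L` in place of `R`). -/
def iterSection (n : ℕ) (g : Green) : ∀ k, IterData n k → Subsemigroup (IterWr n k)
  | 0, D => OrderedDecomposition.symmSection D g
  | k + 1, ⟨D, c⟩ => (D.productHom g fun i => iterSection n g k (c i)).srange

/-! ### Partial automorphisms of the regular rooted tree -/

/-- The vertices of the `k`-level `n`-regular rooted tree: words of length at most `k` over an
`n`-letter alphabet. The root is the empty word. -/
abbrev TreeVertex (n k : ℕ) := {w : List (Fin n) // w.length ≤ k}

/-- The root. -/
def treeRoot (n k : ℕ) : TreeVertex n k := ⟨[], Nat.zero_le k⟩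

/-- The `k`-level `n`-regular rooted tree: the children of a word `w` are the words `w x`. -/
def regularTree (n k : ℕ) : SimpleGraph (TreeVertex n k) where
  Adj u v := (∃ x, v.1 = u.1 ++ [x]) ∨ ∃ x, u.1 = v.1 ++ [x]
  symm := ⟨fun _ _ h => h.symm⟩
  loopless := ⟨fun u h => by rcases h with ⟨x, h⟩ | ⟨x, h⟩ <;> simpa using congrArg List.length h⟩

/-- A partial automorphism: an injective partial map on vertices that fixes the root, is defined
on a connected subtree (with the root) and maps adjacent vertices to adjacent vertices. -/
structure IsPartialAut {n k : ℕ} (φ : IS (TreeVertex n k)) : Prop where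
  root : φ (treeRoot n k) = some (treeRoot n k)
  connected : ((regularTree n k).induce {v | (φ v).isSome}).Connected
  adj : ∀ u v u' v', φ u = some u' → φ v = some v' →
    (regularTree n k).Adj u v → (regularTree n k).Adj u' v'

theorem regularTree_parent_mem {n k : ℕ} {A : Set (TreeVertex n k)} (h0 : treeRoot n k ∈ A)
    (hA : ((regularTree n k).induce A).Connected) {u v : TreeVertex n k} {x : Fin n}
    (hv : v ∈ A) (h : v.1 = u.1 ++ [x]) : u ∈ A := by
  by_contra hu
  have key : ∀ p q : A, ((regularTree n k).induce A).Walk p q →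
      u.1 <+: p.1.1 → u.1 <+: q.1.1 := by
    intro p q w
    induction w with
    | nil => exact id
    | @cons a b c hab _ ih =>
      refine fun ha => ih ?_
      rcases hab with ⟨y, hy⟩ | ⟨y, hy⟩
      · change b.1.1 = a.1.1 ++ [y] at hy
        rw [hy]
        exact ha.trans (List.prefix_append _ _)
      · change a.1.1 = b.1.1 ++ [y] at hy
        rw [hy, List.prefix_concat_iff] at ha
        rcases ha with ha | ha
        · exact absurd (by rw [Subtype.ext (ha.trans hy.symm)]; exact a.2) hu
        · exact ha
  obtain ⟨w⟩ := hA.preconnected ⟨v, hv⟩ ⟨_, h0⟩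
  have := key _ _ w (by rw [h]; exact List.prefix_append _ _)
  have h1 : u = treeRoot n k := Subtype.ext (List.prefix_nil.1 this)
  exact hu (h1 ▸ h0)

theorem regularTree_connected {n k : ℕ} {A : Set (TreeVertex n k)} (h0 : treeRoot n k ∈ A)
    (hA : ∀ (u v : TreeVertex n k) (x : Fin n), v ∈ A → v.1 = u.1 ++ [x] → u ∈ A) :
    ((regularTree n k).induce A).Connected := by
  have key : ∀ (w : List (Fin n)) (hw : w.length ≤ k) (hm : (⟨w, hw⟩ : TreeVertex n k) ∈ A),
      ((regularTree n k).induce A).Reachable ⟨_, h0⟩ ⟨_, hm⟩ := by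
    intro w
    induction w using List.reverseRecOn with
    | nil => exact fun _ _ => SimpleGraph.Reachable.refl _
    | append_singleton w x ih =>
      intro hw hm
      have hw' : w.length ≤ k := by simp at hw; omega
      have hm' := hA ⟨w, hw'⟩ _ x hm rfl
      refine (ih hw' hm').trans (SimpleGraph.Adj.reachable ?_)
      exact Or.inl ⟨x, rfl⟩
  exact { preconnected := fun p q => (key _ p.1.2 p.2).symm.trans (key _ q.1.2 q.2)
          nonempty := ⟨⟨_, h0⟩⟩ }

theorem IsPartialAut.parent_isSome {n k : ℕ} {φ : IS (TreeVertex n k)} (h : IsPartialAut φ)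
    {u v : TreeVertex n k} {x : Fin n} (hv : (φ v).isSome) (e : v.1 = u.1 ++ [x]) :
    (φ u).isSome :=
  regularTree_parent_mem (A := {v | (φ v).isSome}) (by simp [h.root]) h.connected hv e

theorem IsPartialAut.child {n k : ℕ} {φ : IS (TreeVertex n k)} (h : IsPartialAut φ) :
    ∀ (w : List (Fin n)) (u v u' v' : TreeVertex n k) (x : Fin n), u.1 = w →
      v.1 = u.1 ++ [x] → φ u = some u' → φ v = some v' → ∃ y, v'.1 = u'.1 ++ [y] := by
  intro w
  induction w using List.reverseRecOn with
  | nil =>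
    intro u v u' v' x hu hv eu ev
    have : u = treeRoot n k := Subtype.ext hu
    subst this
    obtain rfl : treeRoot n k = u' := by simpa [h.root] using eu
    rcases h.adj _ _ _ _ eu ev (Or.inl ⟨x, hv⟩) with hc | ⟨y, hy⟩
    · exact hc
    · simp [treeRoot] at hy
  | append_singleton w z ih =>
    intro u v u' v' x hu hv eu ev
    rcases h.adj _ _ _ _ eu ev (Or.inl ⟨x, hv⟩) with hc | ⟨y, hy⟩
    · exact hc
    · have hw : w.length ≤ k := by
        have := u.2
        rw [hu] at this
        simp at this
        omega
      obtain ⟨t', ht⟩ := Option.isSome_iff_exists.1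
        (h.parent_isSome (u := ⟨w, hw⟩) (x := z) (by rw [eu]; rfl) hu)
      obtain ⟨y', hy'⟩ := ih ⟨w, hw⟩ u t' u' z rfl hu ht eu
      have : v' = t' := by
        rw [hy] at hy'
        exact Subtype.ext (List.append_inj_left' hy' rfl)
      subst this
      have := φ.inj ev ht
      rw [this] at hv
      have hl := congrArg List.length hv
      rw [hu] at hl
      simp at hl

/-- The semigroup of partial automorphisms of the `k`-level `n`-regular rooted tree. -/
def PAut (n k : ℕ) : Subsemigroup (IS (TreeVertex n k)) where
  carrier := {φ | IsPartialAut φ}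
  mul_mem' := by
    rintro φ ψ hφ hψ
    have hroot : (φ * ψ) (treeRoot n k) = some (treeRoot n k) := by
      simp [IS.mul_apply, hφ.root, hψ.root]
    refine ⟨hroot, regularTree_connected (by simp [hroot]) ?_, ?_⟩
    · intro u v x hv e
      obtain ⟨v'', hv''⟩ := Option.isSome_iff_exists.1 hv
      obtain ⟨v', hv1, hv2⟩ := (PEquiv.trans_eq_some φ ψ v v'').1 hv''
      obtain ⟨u', hu'⟩ := Option.isSome_iff_exists.1 (hφ.parent_isSome (by rw [hv1]; rfl) e)
      obtain ⟨y, hy⟩ := hφ.child _ u v u' v' x rfl e hu' hv1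
      have := hψ.parent_isSome (by rw [hv2]; rfl) hy
      change ((φ * ψ) u).isSome
      simpa [IS.mul_apply, hu'] using this
    · intro u v u'' v'' hu hv huv
      obtain ⟨u', hu1, hu2⟩ := (PEquiv.trans_eq_some φ ψ u u'').1 hu
      obtain ⟨v', hv1, hv2⟩ := (PEquiv.trans_eq_some φ ψ v v'').1 hv
      exact hψ.adj _ _ _ _ hu2 hv2 (hφ.adj _ _ _ _ hu1 hv1 huv)

/-! The semigroups in question are finite inverse monoids, where `a R b` means `a a⁻¹ = b b⁻¹`. In
`IS X` an R-class is therefore a domain; in a partial wreath product it is a domain together with an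
R-class for each entry (`PWr.rel_R_iff`). Inversion exchanges R and L, so every statement about L
reduces to one about R. The working principle is that two elements of a cross-section `C` with the
same R-class are equal, so that comparing domains yields equations.

Products are cross-sections because the elements of `R(M)` are strictly monotone with an upper set
as image. Such a map is determined by its domain, and every domain occurs since points can be
removed one at a time.

Conversely, let `C` be an R-cross-section of `IS n` and let `c x` be its element that is undefined
at `x` only. The maximal path of `c x` that ends in `x` turns out to be a chain, outside of which `c
x` is the identity (`IsCrossSection.exists_isChain`). Paths with a common start never branch, so the
starts name the blocks and the lengths give the orders. Hence `C` contains the generators of some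
`R(M₁, …, M_k)` and is equal to it.

For an R-cross-section `C` of `S ≀ IS n`, the elements with unit entries project onto a
cross-section of `IS n`, which provides the decomposition. The elements acting at one point only
form cross-sections of `S`, conjugate to each other along each block. The unit entries of the lifted
chains have the form `h_l⁻¹ h_{l+1}` (`PWr.exists_coboundary`), so conjugation by a tuple of units
carries a product onto `C`.

Finally, a partial automorphism of a tree amounts to its action on the first level together with its
actions on the subtrees below. This gives the isomorphism with the iterated wreath product, and
induction on the number of levels gives the iterated products. -/

/-! ### Inverse monoids -/

/-- A semigroup with an identity in which every element has an inverse in the sense of the theory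
of inverse semigroups. -/
class UnitalInverse (S : Type*) [Semigroup S] where
  ident : S
  invert : S → S
  ident_mul : ∀ a : S, ident * a = a
  mul_ident : ∀ a : S, a * ident = a
  invert_invert : ∀ a : S, invert (invert a) = a
  invert_mul : ∀ a b : S, invert (a * b) = invert b * invert a
  mul_invert_mul : ∀ a : S, a * invert a * a = a
  mul_invert_comm : ∀ a b : S, a * invert a * (b * invert b) = b * invert b * (a * invert a)

namespace UnitalInverse

section Basic

variable {S : Type*} [Semigroup S] [UnitalInverse S]

attribute [simp] ident_mul mul_ident invert_invert invert_mul

/-- The idempotent `a a⁻¹`. -/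
def src (a : S) : S := a * invert a

theorem src_mul_self (a : S) : src a * a = a := mul_invert_mul a

@[simp] theorem mul_invert_mul' (a : S) : a * (invert a * a) = a := by
  rw [← mul_assoc]; exact mul_invert_mul a

@[simp] theorem mul_invert_mul_left (a b : S) : a * (invert a * (a * b)) = a * b := by
  rw [← mul_assoc (invert a), ← mul_assoc, mul_invert_mul']

@[simp] theorem invert_mul_invert (a : S) : invert a * (a * invert a) = invert a := by
  simpa using mul_invert_mul' (invert a)

@[simp] theorem invert_ident : invert (ident : S) = ident := by
  have := mul_invert_mul' (ident : S)
  simpa using this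

@[simp] theorem src_ident : src (ident : S) = ident := by simp [src]

theorem src_mul_src_of_mul (a h : S) : src a * src (a * h) = src (a * h) := by
  simp [src, mul_assoc]

/-- If `b ∈ a H¹`, then `src a * src b = src b`. Both such equations and the commutation of
idempotents give `src a = src b`. Conversely, `a = src b * a = b * (b⁻¹ * a)`. -/
theorem rel_R_iff {a b : S} : Green.R.rel a b ↔ src a = src b := by
  constructor
  · intro h
    have key : ∀ {a b : S}, rightIdeal a = rightIdeal b → src a * src b = src b := by
      intro a b h
      have hb : b ∈ rightIdeal a := by rw [h]; exact Or.inl rfl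
      rcases hb with rfl | ⟨x, rfl⟩
      · simp [src, mul_assoc]
      · exact src_mul_src_of_mul a x
    have h1 := key h
    have h2 := key (Eq.symm h)
    exact h2.symm.trans ((mul_invert_comm b a).trans h1)
  · intro h
    have key : ∀ {a b : S}, src a = src b → rightIdeal a ⊆ rightIdeal b := by
      intro a b h x hx
      have ha : a = b * (invert b * a) := by
        rw [← mul_assoc]
        change a = src b * a
        rw [← h, src_mul_self]
      rcases hx with rfl | ⟨y, rfl⟩
      · exact Or.inr ⟨_, ha⟩
      · exact Or.inr ⟨invert b * a * y, by rw [← mul_assoc, ← ha]⟩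
    exact Set.Subset.antisymm (key h) (key h.symm)

theorem rel_L_iff {a b : S} : Green.L.rel a b ↔ Green.R.rel (invert a) (invert b) := by
  have key : ∀ c : S, rightIdeal (invert c) = {x | invert x ∈ leftIdeal c} := by
    intro c
    ext x
    constructor
    · rintro (rfl | ⟨h, rfl⟩)
      · exact Or.inl (by simp)
      · exact Or.inr ⟨invert h, by simp⟩
    · rintro (h | ⟨y, h⟩)
      · exact Or.inl (by rw [← h, invert_invert])
      · exact Or.inr ⟨invert y, by rw [← invert_mul, ← h, invert_invert]⟩
  change leftIdeal a = leftIdeal b ↔ rightIdeal (invert a) = rightIdeal (invert b)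
  rw [key, key]
  refine ⟨fun h => by rw [h], fun h => ?_⟩
  ext x
  have := Set.ext_iff.1 h (invert x)
  simpa using this

theorem src_eq_ident_mul {a b : S} (ha : src a = ident) (hb : src b = ident) :
    src (a * b) = ident := by
  unfold src at *
  rw [invert_mul, mul_assoc, ← mul_assoc b, hb, ident_mul, ha]

theorem src_mul_of_src_eq_ident (a : S) {g : S} (hg : src g = ident) : src (a * g) = src a := by
  unfold src at *
  rw [invert_mul, mul_assoc, ← mul_assoc g, hg, ident_mul]

/-- `a a⁻¹ = 1` makes right multiplication by `a` injective, hence surjective by finiteness. The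
resulting left inverse of `a` must be `a⁻¹`. -/
theorem invert_mul_self_of_src [Finite S] {a : S} (ha : src a = ident) : invert a * a = ident := by
  have hinj : Function.Injective fun x : S => x * a := by
    intro x y h
    have := congrArg (· * invert a) h
    simpa [mul_assoc, show a * invert a = ident from ha] using this
  obtain ⟨b, hb⟩ := Finite.surjective_of_injective hinj (ident : S)
  have hb : b * a = ident := hb
  have : invert a = b := by
    have := congrArg (· * invert a) hb
    simpa [mul_assoc, show a * invert a = ident from ha] using this.symm
  rw [this, hb]

/-- The image of a subsemigroup under inversion. -/
def inverted (T : Subsemigroup S) : Subsemigroup S where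
  carrier := {a | invert a ∈ T}
  mul_mem' := by
    intro a b ha hb
    change invert (a * b) ∈ T
    rw [invert_mul]
    exact T.mul_mem hb ha

theorem mem_inverted {T : Subsemigroup S} {a : S} : a ∈ inverted T ↔ invert a ∈ T := Iff.rfl

@[simp] theorem inverted_inverted (T : Subsemigroup S) : inverted (inverted T) = T := by
  ext a; simp [mem_inverted]

theorem isCrossSection_L_iff {T : Subsemigroup S} :
    IsCrossSection .L T ↔ IsCrossSection .R (inverted T) := by
  constructor
  · intro h x
    obtain ⟨t, ⟨h1, h2⟩, h3⟩ := h (invert x)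
    refine ⟨invert t, ⟨by simpa [mem_inverted] using h1, ?_⟩, ?_⟩
    · simpa using rel_L_iff.1 h2
    · rintro y ⟨hy1, hy2⟩
      rw [← h3 (invert y) ⟨hy1, rel_L_iff.2 (by simpa using hy2)⟩, invert_invert]
  · intro h x
    obtain ⟨t, ⟨h1, h2⟩, h3⟩ := h (invert x)
    refine ⟨invert t, ⟨h1, rel_L_iff.2 (by simpa using h2)⟩, ?_⟩
    rintro y ⟨hy1, hy2⟩
    rw [← h3 (invert y) ⟨by simpa [mem_inverted] using hy1, rel_L_iff.1 hy2⟩, invert_invert]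

/-- Transport of an inverse monoid structure along an isomorphism. -/
@[reducible] def ofMulEquiv {S' : Type*} [Semigroup S'] (φ : S' ≃* S) : UnitalInverse S' where
  ident := φ.symm ident
  invert a := φ.symm (invert (φ a))
  ident_mul a := φ.injective (by simp)
  mul_ident a := φ.injective (by simp)
  invert_invert a := by simp
  invert_mul a b := φ.injective (by simp)
  mul_invert_mul a := φ.injective (by simp [mul_assoc])
  mul_invert_comm a b := φ.injective (by simpa using mul_invert_comm (φ a) (φ b))

end Basic

end UnitalInverse

open UnitalInverse

/-! ### General properties of cross-sections -/

section CrossSections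

variable {H : Type*} [Semigroup H]

theorem Green.rel_symm {g : Green} {a b : H} (h : g.rel a b) : g.rel b a := by
  cases g <;> exact Eq.symm h

theorem Green.rel_refl (g : Green) (a : H) : g.rel a a := by
  cases g <;> rfl

theorem Green.rel_trans {g : Green} {a b c : H} (h : g.rel a b) (h' : g.rel b c) : g.rel a c := by
  cases g <;> exact Eq.trans h h'

theorem IsCrossSection.eq_of_rel {g : Green} {C : Subsemigroup H} (hC : IsCrossSection g C)
    {a b : H} (ha : a ∈ C) (hb : b ∈ C) (h : g.rel a b) : a = b :=
  (hC b).unique ⟨ha, h⟩ ⟨hb, g.rel_refl b⟩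

theorem IsCrossSection.exists_rel {g : Green} {C : Subsemigroup H} (hC : IsCrossSection g C)
    (a : H) : ∃ t ∈ C, g.rel t a := (hC a).exists

theorem isCrossSection_of {g : Green} {C : Subsemigroup H}
    (h1 : ∀ a, ∃ t ∈ C, g.rel t a) (h2 : ∀ a ∈ C, ∀ b ∈ C, g.rel a b → a = b) :
    IsCrossSection g C := by
  intro a
  obtain ⟨t, ht, h⟩ := h1 a
  exact ⟨t, ⟨ht, h⟩, fun y hy => h2 y hy.1 t ht (Green.rel_trans hy.2 (Green.rel_symm h))⟩

/-- An element of `C'` is related to one of `C ⊆ C'`, and uniqueness in `C'` identifies them. This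
reduces each classification to a single inclusion. -/
theorem IsCrossSection.eq_of_le {g : Green} {C C' : Subsemigroup H} (hC : IsCrossSection g C)
    (hC' : IsCrossSection g C') (h : C ≤ C') : C = C' := by
  refine le_antisymm h fun x hx => ?_
  obtain ⟨t, ht, hr⟩ := hC.exists_rel x
  rwa [← hC'.eq_of_rel (h ht) hx hr]

theorem Green.rel_map {H' : Type*} [Semigroup H'] (φ : H ≃* H') {g : Green} {a b : H}
    (h : g.rel a b) : g.rel (φ a) (φ b) := by
  have hr : ∀ a : H, rightIdeal (φ a) = φ '' rightIdeal a := by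
    intro a
    ext x
    constructor
    · rintro (rfl | ⟨y, rfl⟩)
      · exact ⟨a, Or.inl rfl, rfl⟩
      · exact ⟨a * φ.symm y, Or.inr ⟨_, rfl⟩, by simp⟩
    · rintro ⟨y, rfl | ⟨z, rfl⟩, rfl⟩
      · exact Or.inl rfl
      · exact Or.inr ⟨φ z, by simp⟩
  have hl : ∀ a : H, leftIdeal (φ a) = φ '' leftIdeal a := by
    intro a
    ext x
    constructor
    · rintro (rfl | ⟨y, rfl⟩)
      · exact ⟨a, Or.inl rfl, rfl⟩
      · exact ⟨φ.symm y * a, Or.inr ⟨_, rfl⟩, by simp⟩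
    · rintro ⟨y, rfl | ⟨z, rfl⟩, rfl⟩
      · exact Or.inl rfl
      · exact Or.inr ⟨φ z, by simp⟩
  cases g
  · change rightIdeal _ = rightIdeal _
    rw [hr, hr, show rightIdeal a = rightIdeal b from h]
  · change leftIdeal _ = leftIdeal _
    rw [hl, hl, show leftIdeal a = leftIdeal b from h]

theorem IsCrossSection.map {H' : Type*} [Semigroup H'] (φ : H ≃* H') {g : Green}
    {C : Subsemigroup H} (hC : IsCrossSection g C) : IsCrossSection g (C.map φ.toMulHom) := by
  refine isCrossSection_of (fun a => ?_) ?_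
  · obtain ⟨t, ht, h⟩ := hC.exists_rel (φ.symm a)
    exact ⟨φ t, ⟨t, ht, rfl⟩, by simpa using Green.rel_map φ h⟩
  · rintro _ ⟨a, ha, rfl⟩ _ ⟨b, hb, rfl⟩ h
    have := Green.rel_map φ.symm h
    rw [hC.eq_of_rel ha hb (by simpa using this)]

theorem IsCrossSection.comap {H' : Type*} [Semigroup H'] (φ : H ≃* H') {g : Green}
    {C : Subsemigroup H'} (hC : IsCrossSection g C) : IsCrossSection g (C.comap φ.toMulHom) := by
  have : C.comap φ.toMulHom = C.map φ.symm.toMulHom := by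
    ext x
    constructor
    · intro hx
      exact ⟨φ x, hx, φ.symm_apply_apply x⟩
    · rintro ⟨y, hy, rfl⟩
      change φ (φ.symm y) ∈ C
      rwa [φ.apply_symm_apply]
  rw [this]
  exact hC.map φ.symm

/-- A subsemigroup is isomorphic to its image under an isomorphism. -/
theorem nonempty_mulEquiv_map {H' : Type*} [Semigroup H'] (φ : H ≃* H') (C : Subsemigroup H) :
    Nonempty (C ≃* C.map φ.toMulHom) :=
  ⟨C.equivMapOfInjective φ.toMulHom φ.injective⟩

/-- Among the powers of `c`, let `p` be one with the smallest right ideal. Then `p c R p`, and both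
lie in `C`. The lemma serves to show that unit parts of `C` act trivially wherever they return to
the same point. -/
theorem IsCrossSection.exists_mul_eq_self [Finite H] {C : Subsemigroup H}
    (hC : IsCrossSection .R C) {c : H} (hc : c ∈ C) :
    ∃ p ∈ Subsemigroup.closure {c}, p * c = p := by
  have hle : Subsemigroup.closure {c} ≤ C := by simpa using hc
  obtain ⟨p, hp, hmin⟩ := Set.exists_min_image (Subsemigroup.closure {c} : Set H)
    (fun p => (rightIdeal p).ncard) (Set.toFinite _) ⟨c, Subsemigroup.subset_closure rfl⟩
  have hpc : p * c ∈ Subsemigroup.closure {c} :=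
    Subsemigroup.mul_mem _ hp (Subsemigroup.subset_closure rfl)
  refine ⟨p, hp, hC.eq_of_rel (hle hpc) (hle hp) ?_⟩
  refine Set.eq_of_subset_of_ncard_le ?_ (hmin _ hpc) (Set.toFinite _)
  rintro x (rfl | ⟨y, rfl⟩)
  · exact Or.inr ⟨c, rfl⟩
  · exact Or.inr ⟨c * y, mul_assoc _ _ _⟩

/-- Let `t ∈ C` represent the class of `a⁻¹ a`. Then `a t R a`, so `a t = a`, and `t = t t⁻¹ t = a⁻¹
a t = a⁻¹ a`. In `IS X` this puts the partial identity on the image of each element of `C` into `C`.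
-/
theorem IsCrossSection.invert_mul_mem [UnitalInverse H] {C : Subsemigroup H}
    (hC : IsCrossSection .R C) {a : H} (ha : a ∈ C) : invert a * a ∈ C := by
  obtain ⟨t, ht, h⟩ := hC.exists_rel (invert a * a)
  rw [rel_R_iff] at h
  have h' : t * invert t = invert a * a := by simpa [src, mul_assoc] using h
  have hat : a * t = a := by
    refine hC.eq_of_rel (C.mul_mem ha ht) ha (rel_R_iff.2 ?_)
    unfold src
    rw [invert_mul, mul_assoc, ← mul_assoc t, h']
    simp [mul_assoc]
  have : t = invert a * a := by
    rw [← src_mul_self t, src, h', mul_assoc, hat]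
  rwa [← this]

theorem IsCrossSection.ident_mem [UnitalInverse H] [Finite H] {C : Subsemigroup H}
    (hC : IsCrossSection .R C) : ident ∈ C := by
  obtain ⟨t, ht, h⟩ := hC.exists_rel ident
  rw [rel_R_iff, src_ident] at h
  rw [← invert_mul_self_of_src h]
  exact hC.invert_mul_mem ht

end CrossSections

/-! ### The symmetric inverse semigroup as an inverse monoid -/

section SymmetricInverse

variable {X : Type*}

theorem IS.mul_eq_some {a b : IS X} {x z : X} :
    (a * b) x = some z ↔ ∃ y, a x = some y ∧ b y = some z := PEquiv.trans_eq_some a b x z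

theorem IS.one_apply (x : X) : (1 : IS X) x = some x := rfl

theorem IS.eq_of_isSome {Y : Type*} {a b : Option Y} (h : ∀ y, a = some y → b = some y)
    (h' : b.isSome = a.isSome) : b = a := by
  cases a with
  | none => simpa using h'
  | some y => exact h y rfl

theorem IS.mul_symm_apply (a : IS X) (x : X) : (a * a.symm) x = (a x).map fun _ => x := by
  rw [IS.mul_apply]
  cases h : a x with
  | none => rfl
  | some y => exact (PEquiv.eq_some_iff a).2 h

instance IS.instUnitalInverse : UnitalInverse (IS X) where
  ident := 1
  invert := PEquiv.symm
  ident_mul := one_mul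
  mul_ident := mul_one
  invert_invert := PEquiv.symm_symm
  invert_mul a b := PEquiv.symm_trans_rev a b
  mul_invert_mul a := by
    refine PEquiv.ext fun x => ?_
    rw [IS.mul_apply, IS.mul_symm_apply]
    cases h : a x <;> simp [h]
  mul_invert_comm a b := by
    refine PEquiv.ext fun x => ?_
    simp only [IS.mul_apply (a * a.symm), IS.mul_apply (b * b.symm), IS.mul_symm_apply]
    cases h : a x <;> cases h' : b x <;> simp [h, h']

theorem IS.rel_R_iff {a b : IS X} : Green.R.rel a b ↔ ∀ x, (a x).isSome = (b x).isSome := by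
  rw [UnitalInverse.rel_R_iff, PEquiv.ext_iff]
  refine forall_congr' fun x => ?_
  change (a * a.symm) x = (b * b.symm) x ↔ _
  rw [IS.mul_symm_apply, IS.mul_symm_apply]
  cases a x <;> cases b x <;> simp

instance IS.instFinite [Finite X] : Finite (IS X) := DFunLike.finite _

end SymmetricInverse

/-! ### The partial wreath product as an inverse monoid -/

namespace PWr

variable {S X : Type*}

instance instFinite [Finite S] [Finite X] : Finite (PWr S X) :=
  Finite.of_injective (fun u : PWr S X => (u.f, u.a)) fun u v h => by
    simp only [Prod.mk.injEq] at h
    exact PWr.ext h.1 h.2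

theorem exists_f {u : PWr S X} {x y : X} (h : u.a x = some y) : ∃ s, u.f x = some s :=
  Option.isSome_iff_exists.1 (by rw [u.dom, h]; rfl)

theorem exists_a {u : PWr S X} {x : X} {s : S} (h : u.f x = some s) : ∃ y, u.a x = some y :=
  Option.isSome_iff_exists.1 (by rw [← u.dom, h]; rfl)

theorem cases_eq (u : PWr S X) (x : X) :
    (u.f x = none ∧ u.a x = none) ∨ ∃ s y, u.f x = some s ∧ u.a x = some y := by
  have := u.dom x
  cases h : u.f x <;> cases h' : u.a x <;> simp_all

variable [Semigroup S]

theorem mul_f_of_none {u : PWr S X} (v : PWr S X) {x : X} (h : u.f x = none) :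
    (u * v).f x = none := by
  rw [mul_f, h]; rfl

theorem mul_f_of_eq {u v : PWr S X} {x y : X} {s : S} (h : u.f x = some s) (h' : u.a x = some y) :
    (u * v).f x = (v.f y).map fun t => s * t := by
  rw [mul_f, h, h']; rfl

theorem mul_a_of_eq {u v : PWr S X} {x y : X} (h' : u.a x = some y) :
    (u * v).a x = v.a y := by
  rw [mul_a, IS.mul_apply, h']; rfl

/-- The element `(f, 1)` of a partial wreath product for a total function `f`. -/
def base (f : X → S) : PWr S X where
  f x := some (f x)
  a := 1
  dom _ := rfl

theorem base_mul_f (f : X → S) (u : PWr S X) (x : X) :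
    (base f * u).f x = (u.f x).map fun s => f x * s :=
  mul_f_of_eq (u := base f) rfl rfl

theorem base_mul_a (f : X → S) (u : PWr S X) : (base f * u).a = u.a := one_mul _

theorem mul_base_a (f : X → S) (u : PWr S X) : (u * base f).a = u.a := mul_one _

theorem base_mul_base (f g : X → S) : base f * base g = base fun x => f x * g x :=
  PWr.ext (funext fun _ => rfl) (one_mul _)

variable [UnitalInverse S]

/-- The inverse of an element of a partial wreath product. -/
def inv (u : PWr S X) : PWr S X where
  f y := (u.a.symm y).bind fun x => (u.f x).map invert
  a := u.a.symm
  dom y := by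
    cases h : u.a.symm y with
    | none => rfl
    | some x =>
      obtain ⟨s, hs⟩ := exists_f ((PEquiv.eq_some_iff _).1 h)
      simp [hs]

theorem inv_f_of_eq {u : PWr S X} {x y : X} {s : S} (h : u.f x = some s) (h' : u.a x = some y) :
    (inv u).f y = some (invert s) := by
  change (u.a.symm y).bind _ = _
  rw [(PEquiv.eq_some_iff _).2 h']
  simp [h]

theorem inv_a_of_eq {u : PWr S X} {x y : X} (h' : u.a x = some y) :
    (inv u).a y = some x := (PEquiv.eq_some_iff _).2 h'

theorem mul_inv_f (u : PWr S X) (x : X) : (u * inv u).f x = (u.f x).map src := by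
  rcases u.cases_eq x with ⟨h, h'⟩ | ⟨s, y, h, h'⟩
  · rw [mul_f, h]; rfl
  · rw [mul_f_of_eq h h', inv_f_of_eq h h', h]; rfl

theorem mul_inv_a (u : PWr S X) (x : X) : (u * inv u).a x = (u.f x).map fun _ => x := by
  change (u.a * u.a.symm) x = _
  rw [IS.mul_symm_apply]
  rcases u.cases_eq x with ⟨h, h'⟩ | ⟨s, y, h, h'⟩ <;> rw [h, h'] <;> rfl

theorem inv_f_none {u : PWr S X} {y : X} (h : u.a.symm y = none) : (inv u).f y = none := by
  change (u.a.symm y).bind _ = _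
  rw [h]; rfl

instance instUnitalInverse : UnitalInverse (PWr S X) where
  ident := base fun _ => ident
  invert := inv
  ident_mul u := PWr.ext (funext fun x => by rw [base_mul_f]; simp) (one_mul _)
  mul_ident u := PWr.ext (funext fun x => by
    rcases u.cases_eq x with ⟨h, h'⟩ | ⟨s, y, h, h'⟩
    · rw [mul_f, h]; rfl
    · rw [mul_f_of_eq h h', h]; simp [base]) (mul_one _)
  invert_invert u := PWr.ext (funext fun x => by
    rcases u.cases_eq x with ⟨h, h'⟩ | ⟨s, y, h, h'⟩
    · rw [inv_f_none, h]
      exact h'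
    · rw [inv_f_of_eq (inv_f_of_eq h h') (inv_a_of_eq h'), h, UnitalInverse.invert_invert])
    (PEquiv.symm_symm _)
  invert_mul u v := PWr.ext (funext fun z => by
    rcases (inv v).cases_eq z with ⟨h, h'⟩ | ⟨s, y, h, h'⟩
    · have h2 : (u * v).a.symm z = none := by
        rw [show (u * v).a.symm = v.a.symm * u.a.symm from PEquiv.symm_trans_rev u.a v.a,
          IS.mul_apply, show v.a.symm z = none from h']
        rfl
      rw [inv_f_none h2, mul_f, h]; rfl
    · rw [mul_f_of_eq h h']
      have hv : v.a y = some z := (PEquiv.eq_some_iff _).1 h'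
      rcases (inv u).cases_eq y with ⟨k, k'⟩ | ⟨t, x, k, k'⟩
      · have h2 : (u * v).a.symm z = none := by
          rw [show (u * v).a.symm = v.a.symm * u.a.symm from PEquiv.symm_trans_rev u.a v.a,
            IS.mul_apply, show v.a.symm z = some y from h']
          exact k'
        rw [inv_f_none h2, k]; rfl
      · have hu : u.a x = some y := (PEquiv.eq_some_iff _).1 k'
        obtain ⟨s', hs'⟩ := exists_f hv
        obtain ⟨t', ht'⟩ := exists_f hu
        have e1 := inv_f_of_eq hs' hv
        have e2 := inv_f_of_eq ht' hu
        rw [h] at e1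
        rw [k] at e2
        cases e1
        cases e2
        have e3 : (u * v).f x = some (t' * s') := by rw [mul_f_of_eq ht' hu, hs']; rfl
        have e4 : (u * v).a x = some z := by rw [mul_a_of_eq hu, hv]
        rw [inv_f_of_eq e3 e4, k]
        simp)
    (PEquiv.symm_trans_rev u.a v.a)
  mul_invert_mul u := by
    refine PWr.ext (funext fun x => ?_) (UnitalInverse.mul_invert_mul u.a)
    have h1 := mul_inv_f u x
    have h2 := mul_inv_a u x
    cases h : u.f x with
    | none => rw [mul_f, h1, h]; rfl
    | some s =>
      rw [h] at h1 h2
      rw [mul_f_of_eq h1 h2, h]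
      simp [src_mul_self]
  mul_invert_comm u v := by
    refine PWr.ext (funext fun x => ?_) (UnitalInverse.mul_invert_comm u.a v.a)
    have h1 := mul_inv_f u x
    have h2 := mul_inv_a u x
    have k1 := mul_inv_f v x
    have k2 := mul_inv_a v x
    cases h : u.f x with
    | none =>
      rw [h] at h1
      rw [mul_f_of_none _ h1]
      cases k : v.f x with
      | none =>
        rw [k] at k1
        rw [mul_f_of_none _ k1]
      | some t =>
        rw [k] at k1 k2
        rw [mul_f_of_eq k1 k2, h1]; rfl
    | some s =>
      rw [h] at h1 h2
      cases k : v.f x with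
      | none =>
        rw [k] at k1
        rw [mul_f_of_eq h1 h2, mul_f_of_none _ k1, k1]; rfl
      | some t =>
        rw [k] at k1 k2
        rw [mul_f_of_eq h1 h2, mul_f_of_eq k1 k2, h1, k1]
        simp only [Option.map_some, src]
        rw [UnitalInverse.mul_invert_comm]

theorem rel_R_iff {u v : PWr S X} :
    Green.R.rel u v ↔ ∀ x, (u.f x).map src = (v.f x).map src := by
  rw [UnitalInverse.rel_R_iff]
  change u * inv u = v * inv v ↔ _
  constructor
  · intro h x
    rw [← mul_inv_f, h, mul_inv_f]
  · intro h
    refine PWr.ext (funext fun x => by rw [mul_inv_f, mul_inv_f, h]) (PEquiv.ext fun x => ?_)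
    rw [mul_inv_a, mul_inv_a]
    have := h x
    cases h1 : u.f x <;> cases h2 : v.f x <;> simp_all

end PWr

/-! ### The semigroups `R(M₁, …, M_k)` are cross-sections -/

/-- Points are removed one at a time. After an element `c` has removed `j ∈ A`, it remains to remove
the image of `A \ {j}` under `c`, which has one point less than `A`. -/
theorem IS.exists_isSome_iff_notMem {X : Type*} [Finite X] {K : Subsemigroup (IS X)}
    (h1 : 1 ∈ K) (h : ∀ j, ∃ c ∈ K, ∀ x, (c x).isSome ↔ x ≠ j) (A : Set X) :
    ∃ c ∈ K, ∀ x, (c x).isSome ↔ x ∉ A := by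
  induction hk : A.ncard generalizing A with
  | zero =>
    rw [Set.ncard_eq_zero (Set.toFinite _)] at hk
    subst hk
    exact ⟨1, h1, fun x => by simp [IS.one_apply]⟩
  | succ k ih =>
    obtain ⟨j, hj⟩ : A.Nonempty := by
      rw [Set.nonempty_iff_ne_empty]
      rintro rfl
      simp at hk
    obtain ⟨c, hc, hcj⟩ := h j
    have hB : {y | ∃ x ∈ A, c x = some y}.ncard = k := by
      have h2 : (A \ {j}).ncard = k := by
        rw [Set.ncard_sdiff_singleton_of_mem hj, hk]; rfl
      rw [← h2]
      symm
      refine Set.ncard_congr (fun x hx => (c x).get ((hcj x).2 hx.2)) ?_ ?_ ?_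
      · exact fun x hx => ⟨x, hx.1, by simp⟩
      · intro x y hx hy hxy
        refine c.inj (Option.some_get ((hcj x).2 hx.2)).symm ?_
        rw [Option.mem_def, hxy, Option.some_get]
      · rintro y ⟨x, hx, hxy⟩
        exact ⟨x, ⟨hx, (hcj x).1 (by rw [hxy]; rfl)⟩, by simp [hxy]⟩
    obtain ⟨d, hd, hdB⟩ := ih _ hB
    refine ⟨c * d, K.mul_mem hc hd, fun x => ?_⟩
    rw [IS.mul_apply]
    cases hx : c x with
    | none =>
      have : x = j := by
        by_contra hxj
        have := (hcj x).2 hxj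
        simp [hx] at this
      simp [this, hj]
    | some y =>
      rw [Option.bind_some, hdB, not_iff_not]
      constructor
      · rintro ⟨x', hx', h'⟩
        rwa [c.inj hx h']
      · exact fun hxA => ⟨x, hxA, hx⟩

theorem IS.isCrossSection_of_isSome {X : Type*} [Finite X] {K : Subsemigroup (IS X)}
    (h1 : 1 ∈ K) (h : ∀ j, ∃ c ∈ K, ∀ x, (c x).isSome ↔ x ≠ j)
    (hu : ∀ a ∈ K, ∀ b ∈ K, (∀ x, (a x).isSome = (b x).isSome) → a = b) :
    IsCrossSection .R K := by
  refine isCrossSection_of (fun a => ?_) fun a ha b hb hab => hu a ha b hb (IS.rel_R_iff.1 hab)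
  obtain ⟨c, hc, hca⟩ := IS.exists_isSome_iff_notMem h1 h {x | a x = none}
  refine ⟨c, hc, IS.rel_R_iff.2 fun x => ?_⟩
  rw [Bool.eq_iff_iff, hca]
  simp [Option.isSome_iff_ne_none]

/-! ### The semigroup `R(M)` of a single chain -/

theorem chain_apply {r : ℕ} (j x : Fin r) :
    chain j x = if x = j then none else some (Fin.cycleRange j x) := by
  classical
  rw [chain, IS.mul_apply]
  by_cases h : x = j
  · rw [if_pos h]
    rw [show PEquiv.ofSet {x | x ≠ j} x = none from by simp [PEquiv.ofSet, h]]
    rfl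
  · rw [if_neg h]
    rw [show PEquiv.ofSet {x | x ≠ j} x = some x from by simp [PEquiv.ofSet, h]]
    rfl

theorem chain_self {r : ℕ} (j : Fin r) : chain j j = none := by simp [chain_apply]

theorem chain_of_gt {r : ℕ} {j x : Fin r} (h : j < x) : chain j x = some x := by
  rw [chain_apply, if_neg h.ne', Fin.cycleRange_of_gt h]

theorem chain_of_lt {r : ℕ} {j x y : Fin r} (h : x < j) (hy : (y : ℕ) = x + 1) :
    chain j x = some y := by
  rw [chain_apply, if_neg h.ne]
  congr 1
  rw [Fin.ext_iff, Fin.coe_cycleRange_of_lt h, hy]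

theorem isSome_chain {r : ℕ} (j x : Fin r) : (chain j x).isSome ↔ x ≠ j := by
  rw [chain_apply]; split <;> simp_all

/-- The strictly monotone partial maps of a linear order whose image is an upper set. -/
def upperMonotone (X : Type*) [LinearOrder X] : Subsemigroup (IS X) where
  carrier := {a | (∀ x y u v, a x = some u → a y = some v → x < y → u < v) ∧
    ∀ x u v, a x = some u → u ≤ v → ∃ y, a y = some v}
  mul_mem' := by
    rintro a b ⟨ha, ha'⟩ ⟨hb, hb'⟩
    constructor
    · intro x y u v hx hy hxy
      obtain ⟨x', hx1, hx2⟩ := IS.mul_eq_some.1 hx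
      obtain ⟨y', hy1, hy2⟩ := IS.mul_eq_some.1 hy
      exact hb _ _ _ _ hx2 hy2 (ha _ _ _ _ hx1 hy1 hxy)
    · intro x u v hx huv
      obtain ⟨x', hx1, hx2⟩ := IS.mul_eq_some.1 hx
      obtain ⟨y', hy'⟩ := hb' _ _ _ hx2 huv
      have hxy : x' ≤ y' := by
        by_contra hlt
        exact absurd (hb _ _ _ _ hy' hx2 (not_le.1 hlt)) (not_lt.2 huv)
      obtain ⟨y, hy⟩ := ha' _ _ _ hx1 hxy
      exact ⟨y, IS.mul_eq_some.2 ⟨y', hy, hy'⟩⟩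

/-- Reading the domain downwards from its largest element, each value is forced: it must be the
largest element not yet taken. -/
theorem upperMonotone_unique {X : Type*} [LinearOrder X] [Finite X] {a b : IS X}
    (ha : a ∈ upperMonotone X) (hb : b ∈ upperMonotone X)
    (h : ∀ x, (a x).isSome = (b x).isSome) : a = b := by
  -- If `u < v`, then `v = a y` for some `y` because the image of `a` is an upper set, and `x < y`
  -- by monotonicity. There `a` and `b` agree, so `b y = v = b x`, against injectivity.
  have key : ∀ {a b : IS X}, a ∈ upperMonotone X → b ∈ upperMonotone X →
      ∀ x u v, a x = some u → b x = some v → (∀ y, x < y → a y = b y) → v ≤ u := by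
    intro a b ha hb x u v hx hx' ih
    by_contra hlt
    rw [not_le] at hlt
    obtain ⟨y, hy⟩ := ha.2 x u v hx hlt.le
    have hxy : x < y := by
      by_contra hle
      rcases (not_lt.1 hle).lt_or_eq with h | rfl
      · exact absurd (ha.1 _ _ _ _ hy hx h) (not_lt.2 hlt.le)
      · rw [hx] at hy
        cases hy
        exact lt_irrefl _ hlt
    have := ih y hxy
    rw [hy] at this
    exact hxy.ne (b.inj hx' this.symm)
  refine PEquiv.ext fun x => ?_
  have wf : WellFounded fun x y : X => y < x := wellFounded_gt
  induction x using wf.induction with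
  | _ x ih =>
    cases hx : a x with
    | none =>
      have := h x
      rw [hx] at this
      cases hb : b x <;> simp_all
    | some u =>
      obtain ⟨v, hv⟩ := Option.isSome_iff_exists.1 (by rw [← h x, hx]; rfl)
      rw [hv, le_antisymm (key hb ha x v u hv hx fun y hy => (ih y hy).symm)
        (key ha hb x u v hx hv ih)]

theorem chain_mem_upperMonotone {r : ℕ} (j : Fin r) : chain j ∈ upperMonotone (Fin r) := by
  constructor
  · intro x y u v hx hy hxy
    rw [Fin.lt_def] at *
    have key : ∀ x u : Fin r, chain j x = some u →
        ((x : ℕ) < j ∧ (u : ℕ) = x + 1) ∨ ((j : ℕ) < x ∧ u = x) := by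
      intro x u hx
      rcases lt_trichotomy x j with h | rfl | h
      · rw [chain_of_lt (y := ⟨x + 1, by omega⟩) h rfl] at hx
        cases hx
        exact Or.inl ⟨h, rfl⟩
      · rw [chain_self] at hx
        cases hx
      · rw [chain_of_gt h] at hx
        cases hx
        exact Or.inr ⟨h, rfl⟩
    rcases key x u hx with ⟨h1, h2⟩ | ⟨h1, rfl⟩ <;> rcases key y v hy with ⟨h3, h4⟩ | ⟨h3, rfl⟩ <;>
      omega
  · intro x u v hx huv
    -- The least point is not in the image of any chain; this makes the preimage `v - 1` below
    -- legitimate.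
    have hu : 0 < (u : ℕ) := by
      rcases lt_trichotomy x j with h | rfl | h
      · rw [chain_of_lt (y := ⟨x + 1, by omega⟩) h rfl] at hx
        rw [← Option.some.inj hx]
        exact Nat.succ_pos _
      · rw [chain_self] at hx
        cases hx
      · rw [chain_of_gt h] at hx
        cases hx
        exact (Nat.zero_le _).trans_lt h
    rcases lt_or_ge j v with h | h
    · exact ⟨v, chain_of_gt h⟩
    · rw [Fin.le_def] at *
      exact ⟨⟨v - 1, by omega⟩, chain_of_lt (by rw [Fin.lt_def]; simp; omega) (by simp; omega)⟩

theorem one_mem_upperMonotone {X : Type*} [LinearOrder X] : 1 ∈ upperMonotone X := by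
  constructor
  · intro x y u v hx hy hxy
    cases hx
    cases hy
    exact hxy
  · exact fun x u v _ _ => ⟨v, rfl⟩

theorem chainSection_le_upperMonotone (r : ℕ) : chainSection r .R ≤ upperMonotone (Fin r) := by
  refine Subsemigroup.closure_le.2 ?_
  rintro _ (rfl | ⟨j, rfl⟩)
  · exact one_mem_upperMonotone
  · exact chain_mem_upperMonotone j

theorem one_mem_chainSection (r : ℕ) : 1 ∈ chainSection r .R :=
  Subsemigroup.subset_closure (Set.mem_insert _ _)

theorem chain_mem_chainSection {r : ℕ} (j : Fin r) : chain j ∈ chainSection r .R :=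
  Subsemigroup.subset_closure (Set.mem_insert_of_mem _ ⟨j, rfl⟩)

theorem chainSection_unique {r : ℕ} {a b : IS (Fin r)} (ha : a ∈ chainSection r .R)
    (hb : b ∈ chainSection r .R) (h : ∀ x, (a x).isSome = (b x).isSome) : a = b :=
  upperMonotone_unique (chainSection_le_upperMonotone r ha) (chainSection_le_upperMonotone r hb) h

/-! ### The semigroup `R(M₁, …, M_k)` of several blocks -/

namespace OrderedDecomposition

variable {n : ℕ} (D : OrderedDecomposition n)

theorem glue_one : D.glue 1 = 1 := by
  refine PEquiv.ext fun x => ?_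
  obtain ⟨⟨i, p⟩, rfl⟩ := D.elt.surjective x
  rw [glue_elt]
  rfl

theorem glue_symm (a : ∀ i, IS (Fin (D.size i))) :
    (D.glue a).symm = D.glue fun i => (a i).symm := by
  refine PEquiv.ext fun x => ?_
  obtain ⟨⟨i, p⟩, rfl⟩ := D.elt.surjective x
  refine Option.ext fun y => ?_
  obtain ⟨⟨j, q⟩, rfl⟩ := D.elt.surjective y
  rw [PEquiv.eq_some_iff, glue_elt, glue_elt]
  simp only [Option.map_eq_some_iff, EmbeddingLike.apply_eq_iff_eq, Sigma.mk.injEq]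
  constructor
  · rintro ⟨p', h, rfl, h'⟩
    cases h'
    exact ⟨q, (PEquiv.eq_some_iff _).2 h, rfl, HEq.rfl⟩
  · rintro ⟨p', h, rfl, h'⟩
    cases h'
    exact ⟨p, (PEquiv.eq_some_iff _).1 h, rfl, HEq.rfl⟩

theorem glue_isSome (a : ∀ i, IS (Fin (D.size i))) (i : Fin D.k) (p : Fin (D.size i)) :
    (D.glue a (D.elt ⟨i, p⟩)).isSome = (a i p).isSome := by
  rw [glue_elt, Option.isSome_map]

theorem blockChain_elt (i : Fin D.k) (j p : Fin (D.size i)) :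
    D.blockChain ⟨i, j⟩ (D.elt ⟨i, p⟩) = (chain j p).map fun q => D.elt ⟨i, q⟩ := by
  rw [blockChain, glue_elt, Function.update_self]

theorem blockChain_elt_of_ne {i i' : Fin D.k} (h : i' ≠ i) (j : Fin (D.size i))
    (p : Fin (D.size i')) :
    D.blockChain ⟨i, j⟩ (D.elt ⟨i', p⟩) = some (D.elt ⟨i', p⟩) := by
  rw [blockChain, glue_elt, Function.update_of_ne h]
  rfl

theorem isSome_blockChain (q : Σ i, Fin (D.size i)) (x : Fin n) :
    (D.blockChain q x).isSome ↔ x ≠ D.elt q := by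
  obtain ⟨⟨i', p⟩, rfl⟩ := D.elt.surjective x
  obtain ⟨i, j⟩ := q
  rw [D.elt.injective.ne_iff]
  by_cases h : i' = i
  · subst h
    rw [blockChain_elt, Option.isSome_map, isSome_chain]
    simp
  · rw [blockChain_elt_of_ne _ h]
    simp [h]

/-- The partial bijections that preserve every block and act on it as an element of `R(M i)`. -/
def glueSection : Subsemigroup (IS (Fin n)) where
  carrier := {a | ∃ b : ∀ i, IS (Fin (D.size i)), (∀ i, b i ∈ chainSection (D.size i) .R) ∧
    D.glue b = a}
  mul_mem' := by
    rintro _ _ ⟨b, hb, rfl⟩ ⟨c, hc, rfl⟩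
    exact ⟨fun i => b i * c i, fun i => Subsemigroup.mul_mem _ (hb i) (hc i), D.glue_mul b c⟩

theorem glueSection_unique {a b : IS (Fin n)} (ha : a ∈ D.glueSection) (hb : b ∈ D.glueSection)
    (h : ∀ x, (a x).isSome = (b x).isSome) : a = b := by
  obtain ⟨a, ha, rfl⟩ := ha
  obtain ⟨b, hb, rfl⟩ := hb
  congr 1
  funext i
  refine chainSection_unique (ha i) (hb i) fun p => ?_
  have := h (D.elt ⟨i, p⟩)
  rwa [glue_isSome, glue_isSome] at this

theorem symmSection_le_glueSection : D.symmSection .R ≤ D.glueSection := by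
  refine Subsemigroup.closure_le.2 ?_
  rintro _ (rfl | ⟨⟨i, j⟩, rfl⟩)
  · exact ⟨1, fun i => one_mem_chainSection _, D.glue_one⟩
  · refine ⟨_, fun i' => ?_, rfl⟩
    by_cases h : i' = i
    · subst h
      rw [Function.update_self]
      exact chain_mem_chainSection j
    · rw [Function.update_of_ne h]
      exact one_mem_chainSection _

theorem one_mem_symmSection : 1 ∈ D.symmSection .R :=
  Subsemigroup.subset_closure (Set.mem_insert _ _)

theorem blockChain_mem_symmSection (q : Σ i, Fin (D.size i)) : D.blockChain q ∈ D.symmSection .R :=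
  Subsemigroup.subset_closure (Set.mem_insert_of_mem _ ⟨q, rfl⟩)

theorem isCrossSection_symmSection_R : IsCrossSection .R (D.symmSection .R) := by
  refine IS.isCrossSection_of_isSome D.one_mem_symmSection (fun j => ?_) fun a ha b hb h =>
    D.glueSection_unique (D.symmSection_le_glueSection ha) (D.symmSection_le_glueSection hb) h
  refine ⟨_, D.blockChain_mem_symmSection (D.elt.symm j), fun x => ?_⟩
  rw [isSome_blockChain, Equiv.apply_symm_apply]

/-- The elements of `glueSection` are determined by their domains, and `symmSection` already
supplies every domain. The equality is what allows an element of `R(M₁, …, M_k)` to be split into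
independent blocks. -/
theorem glueSection_eq : D.glueSection = D.symmSection .R := by
  refine le_antisymm (fun a ha => ?_) D.symmSection_le_glueSection
  obtain ⟨b, hb, h⟩ := D.isCrossSection_symmSection_R.exists_rel a
  rwa [← D.glueSection_unique (D.symmSection_le_glueSection hb) ha (IS.rel_R_iff.1 h)]

theorem symmSection_L : D.symmSection .L = inverted (D.symmSection .R) := rfl

theorem isCrossSection_symmSection (g : Green) : IsCrossSection g (D.symmSection g) := by
  cases g
  · exact D.isCrossSection_symmSection_R
  · rw [symmSection_L, isCrossSection_L_iff, inverted_inverted]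
    exact D.isCrossSection_symmSection_R

end OrderedDecomposition

/-! ### Classification of the cross-sections of the symmetric inverse semigroup -/

section Classification

variable {X : Type*}

/-- `z 0, …, z r` is a path of `a` that ends in `x` and cannot be extended to the left. -/
structure IsMaxPath (a : IS X) (x : X) (r : ℕ) (z : ℕ → X) : Prop where
  last : z r = x
  step : ∀ i < r, a (z i) = some (z (i + 1))
  first : ∀ w, a w ≠ some (z 0)

/-- An equality `z i = z j` with `i < j` can be pushed forward until the right side is `z r`. There
`a` is undefined, while the left side still has a successor. -/
theorem path_injOn {a : IS X} {r : ℕ} {z : ℕ → X} (hx : a (z r) = none)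
    (step : ∀ i < r, a (z i) = some (z (i + 1))) :
    ∀ i ≤ r, ∀ j ≤ r, z i = z j → i = j := by
  have key : ∀ d i j, i < j → j + d = r → z i ≠ z j := by
    intro d
    induction d with
    | zero =>
      intro i j hij hj h
      obtain rfl : j = r := hj
      rw [← h, step i hij] at hx
      cases hx
    | succ d ih =>
      intro i j hij hj h
      refine ih (i + 1) (j + 1) (by omega) (by omega) ?_
      have h1 := step i (by omega)
      rw [h, step j (by omega)] at h1
      exact (Option.some.inj h1).symm
  intro i hi j hj h
  rcases lt_trichotomy i j with hij | hij | hij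
  · exact absurd h (key (r - j) i j hij (by omega))
  · exact hij
  · exact absurd h.symm (key (r - i) j i hij (by omega))

theorem exists_isMaxPath [Finite X] (a : IS X) {x : X} (hx : a x = none) :
    ∃ r z, IsMaxPath a x r z := by
  classical
  let P : ℕ → Prop := fun r => ∃ z : ℕ → X, z r = x ∧ ∀ i < r, a (z i) = some (z (i + 1))
  have hP0 : P 0 := ⟨fun _ => x, rfl, fun i hi => absurd hi (Nat.not_lt_zero i)⟩
  have hbound : ∀ r, P r → r ≤ Nat.card X := by
    rintro r ⟨z, hz, hs⟩
    have hinj := path_injOn (by rw [hz]; exact hx) hs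
    have : Function.Injective fun i : Fin (r + 1) => z i := fun i j h =>
      Fin.ext (hinj i (by omega) j (by omega) h)
    have := Nat.card_le_card_of_injective _ this
    rw [Nat.card_fin] at this
    omega
  obtain ⟨z, hz, hs⟩ := Nat.findGreatest_spec (P := P) (Nat.zero_le (Nat.card X)) hP0
  refine ⟨_, z, hz, hs, fun w hw => ?_⟩
  have hP : P (Nat.findGreatest P (Nat.card X) + 1) := by
    refine ⟨fun i => if i = 0 then w else z (i - 1), by simpa using hz, fun i hi => ?_⟩
    rcases Nat.eq_zero_or_pos i with rfl | hi0
    · simpa using hw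
    · have := hs (i - 1) (by omega)
      beta_reduce
      rw [if_neg hi0.ne', if_neg (by omega), this, Nat.sub_add_cancel hi0, Nat.add_sub_cancel]
  have := Nat.le_findGreatest (hbound _ hP) hP
  omega

/-- Followed backwards from `x`, both paths have the same predecessors by injectivity of `a`, and
maximality makes them stop together. -/
theorem IsMaxPath.unique {a : IS X} {x : X} {r r' : ℕ} {z z' : ℕ → X} (h : IsMaxPath a x r z)
    (h' : IsMaxPath a x r' z') : r = r' ∧ ∀ i ≤ r, z i = z' i := by
  have key : ∀ {r r' : ℕ} {z z' : ℕ → X}, IsMaxPath a x r z → IsMaxPath a x r' z' →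
      ∀ k ≤ r, k ≤ r' ∧ z (r - k) = z' (r' - k) := by
    intro r r' z z' h h' k
    induction k with
    | zero => exact fun _ => ⟨Nat.zero_le _, by simp [h.last, h'.last]⟩
    | succ k ih =>
      intro hk
      obtain ⟨h1, h2⟩ := ih (by omega)
      have h3 := h.step (r - (k + 1)) (by omega)
      rw [show r - (k + 1) + 1 = r - k by omega, h2] at h3
      have h4 : k + 1 ≤ r' := by
        by_contra hlt
        rw [show r' - k = 0 by omega] at h3
        exact h'.first _ h3
      have h5 := h'.step (r' - (k + 1)) (by omega)
      rw [show r' - (k + 1) + 1 = r' - k by omega] at h5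
      exact ⟨h4, a.inj h3 h5⟩
  have hr : r = r' := le_antisymm (key h h' r le_rfl).1 (key h' h r' le_rfl).1
  subst hr
  refine ⟨rfl, fun i hi => ?_⟩
  have := (key h h' (r - i) (by omega)).2
  rwa [show r - (r - i) = i by omega] at this

/-- Sending the only missing point `x` to the missed value `z 0` extends `a` to an injective
self-map of a finite set, which is surjective. -/
theorem IsMaxPath.exists_preimage [Finite X] {a : IS X} {x : X} {r : ℕ} {z : ℕ → X}
    (h : IsMaxPath a x r z) (hd : ∀ y, (a y).isSome ↔ y ≠ x) {w : X} (hw : w ≠ z 0) :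
    ∃ y, y ≠ x ∧ a y = some w := by
  classical
  let σ : X → X := fun y => (a y).getD (z 0)
  have hσ : ∀ y, a y = none ∧ σ y = z 0 ∨ ∃ v, a y = some v ∧ σ y = v := by
    intro y
    cases hy : a y <;> simp [σ, hy]
  have hinj : Function.Injective σ := by
    intro y y' hyy
    rcases hσ y with ⟨h1, h2⟩ | ⟨v, h1, h2⟩ <;> rcases hσ y' with ⟨h3, h4⟩ | ⟨v', h3, h4⟩
    · have : ∀ y, a y = none → y = x := fun y hy => by
        by_contra hne
        have := (hd y).2 hne
        simp [hy] at this
      rw [this y h1, this y' h3]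
    · exact absurd (by rw [h3, ← h4, ← hyy, h2]) (h.first y')
    · exact absurd (by rw [h1, ← h2, hyy, h4]) (h.first y)
    · refine a.inj h1 (show a y' = some v from ?_)
      rw [h3, ← h4, ← hyy, h2]
  obtain ⟨y, hy⟩ := Finite.surjective_of_injective hinj w
  rcases hσ y with ⟨h1, h2⟩ | ⟨v, h1, h2⟩
  · exact absurd (hy.symm.trans h2) hw
  · refine ⟨y, (hd y).1 (by rw [h1]; rfl), ?_⟩
    rw [h1, ← h2, hy]

/-- `a` is the chain `[z 0, …, z r]`. -/
structure IsChainMap (a : IS X) (r : ℕ) (z : ℕ → X) : Prop where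
  step : ∀ i < r, a (z i) = some (z (i + 1))
  last : a (z r) = none
  fixed : ∀ w, (∀ i ≤ r, w ≠ z i) → a w = some w

theorem IsChainMap.injOn {a : IS X} {r : ℕ} {z : ℕ → X} (h : IsChainMap a r z) :
    ∀ i ≤ r, ∀ j ≤ r, z i = z j → i = j := path_injOn h.last h.step

theorem IsChainMap.isMaxPath {a : IS X} {r : ℕ} {z : ℕ → X} (h : IsChainMap a r z) :
    IsMaxPath a (z r) r z := by
  refine ⟨rfl, h.step, fun w hw => ?_⟩
  by_cases hwz : ∃ i ≤ r, w = z i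
  · obtain ⟨i, hi, rfl⟩ := hwz
    rcases hi.lt_or_eq with hlt | rfl
    · rw [h.step i hlt] at hw
      have := h.injOn (i + 1) hlt 0 (Nat.zero_le _) (Option.some.inj hw)
      omega
    · rw [h.last] at hw
      cases hw
  · push Not at hwz
    rw [h.fixed w hwz] at hw
    exact hwz 0 (Nat.zero_le _) (Option.some.inj hw)

theorem IS.isSome_mul {a b : IS X} {x : X} :
    ((a * b) x).isSome ↔ ∃ y, a x = some y ∧ (b y).isSome := by
  rw [IS.mul_apply]
  cases a x <;> simp

theorem IsCrossSection.eq_of_isSome {C : Subsemigroup (IS X)} (hC : IsCrossSection .R C) {a b : IS X}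
    (ha : a ∈ C) (hb : b ∈ C) (h : ∀ x, (a x).isSome ↔ (b x).isSome) : a = b :=
  hC.eq_of_rel ha hb (IS.rel_R_iff.2 fun x => Bool.eq_iff_iff.2 (h x))

/-- The path is the maximal one of `c x`. The shape of `c (z i)` off the path comes from partial
identities in `C`, its shape on the path from the relations `c (z i) * c x = c x * c (z (i + 1))`.
-/
theorem IsCrossSection.exists_isChain [Finite X] {C : Subsemigroup (IS X)}
    (hC : IsCrossSection .R C) {c : X → IS X} (hc : ∀ x, c x ∈ C)
    (hd : ∀ x y, (c x y).isSome ↔ y ≠ x) (x : X) :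
    ∃ (r : ℕ) (z : ℕ → X), z r = x ∧ ∀ i ≤ r, IsChainMap (c (z i)) i z := by
  have hnone : ∀ y, c y y = none := fun y => by
    have := (hd y y).not.2 (by simp)
    simpa using this
  obtain ⟨r, z, hz⟩ := exists_isMaxPath (c x) (hnone x)
  have hinj := path_injOn (by rw [hz.last]; exact hnone x) hz.step
  -- `C` contains the partial identity on the complement of `z 0, …, z (i - 1)`. If `a` is this
  -- element, then the image of `a * c x` misses precisely `z 0` and the successors `z 1, …, z i`,
  -- so `invert_mul_mem` gives the next one.
  have hidem : ∀ i ≤ r + 1, ∃ a ∈ C, (∀ w, (∀ l < i, w ≠ z l) → a w = some w) ∧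
      ∀ l < i, a (z l) = none := by
    intro i
    induction i with
    | zero => exact fun _ => ⟨_, hC.ident_mem, fun w _ => rfl, fun l hl => absurd hl (by omega)⟩
    | succ i ih =>
      intro hi
      obtain ⟨a, ha, ha1, ha2⟩ := ih (by omega)
      refine ⟨_, hC.invert_mul_mem (C.mul_mem ha (hc x)), fun w hw => ?_, fun l hl => ?_⟩
      · obtain ⟨y, hy1, hy2⟩ := hz.exists_preimage (hd x) (hw 0 (by omega))
        have hy : (a * c x) y = some w := by
          refine IS.mul_eq_some.2 ⟨y, ha1 y fun l hl h => ?_, hy2⟩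
          rw [h, hz.step l (by omega)] at hy2
          exact hw (l + 1) (by omega) (Option.some.inj hy2).symm
        exact IS.mul_eq_some.2 ⟨y, (PEquiv.eq_some_iff _).2 hy, hy⟩
      · rw [Option.eq_none_iff_forall_ne_some]
        intro v hv
        obtain ⟨y, hy1, -⟩ := IS.mul_eq_some.1 hv
        obtain ⟨y', hy2, hy3⟩ := IS.mul_eq_some.1 ((PEquiv.eq_some_iff _).1 hy1)
        rcases Nat.eq_zero_or_pos l with rfl | hl0
        · exact hz.first _ hy3
        · have h1 := hz.step (l - 1) (by omega)
          rw [Nat.sub_add_cancel hl0] at h1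
          have h2 := (c x).inj h1 hy3
          have h3 : y = y' := by
            by_contra hne
            have hy4 : ∃ m < i, y = z m := by
              by_contra hno
              push Not at hno
              rw [ha1 y hno] at hy2
              exact hne (Option.some.inj hy2)
            obtain ⟨m, hm, rfl⟩ := hy4
            rw [ha2 m hm] at hy2
            cases hy2
          rw [h3, ← h2, ha2 (l - 1) (by omega)] at hy2
          cases hy2
  have hfix : ∀ i ≤ r, ∀ w, (∀ l ≤ i, w ≠ z l) → c (z i) w = some w := by
    intro i hi w hw
    obtain ⟨a, ha, ha1, ha2⟩ := hidem i (by omega)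
    obtain ⟨b, hb, hb1, hb2⟩ := hidem (i + 1) (by omega)
    -- Restricted to the complement of the earlier points, `c (z i)` has the domain of the next
    -- partial identity and therefore equals it.
    have hab : a * c (z i) = b := by
      refine hC.eq_of_isSome (C.mul_mem ha (hc _)) hb fun v => ?_
      by_cases hv : ∃ l < i, v = z l
      · obtain ⟨l, hl, rfl⟩ := hv
        rw [hb2 l (by omega), IS.mul_apply, ha2 l hl]
        rfl
      · push Not at hv
        rw [IS.mul_apply, ha1 v hv, Option.bind_some, hd]
        by_cases hvi : v = z i
        · subst hvi
          simp [hb2 i (by omega)]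
        · rw [hb1 v fun l hl => (Nat.lt_succ_iff_lt_or_eq.1 hl).elim (hv l) fun h => h ▸ hvi]
          simp [hvi]
    have h1 : (a * c (z i)) w = some w := by
      rw [hab]
      exact hb1 w fun l hl => hw l (by omega)
    rwa [IS.mul_apply, ha1 w fun l hl => hw l (by omega)] at h1
  -- Both products are undefined exactly at `x` and `z i`.
  have hcomm : ∀ i < r, c (z i) * c x = c x * c (z (i + 1)) := by
    intro i hi
    have hx : c (z i) x = some x := hfix i hi.le x fun l hl h => by
      have := hinj r le_rfl l (by omega) (hz.last.trans h)
      omega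
    refine hC.eq_of_isSome (C.mul_mem (hc _) (hc _)) (C.mul_mem (hc _) (hc _)) fun w => ?_
    simp only [IS.isSome_mul, hd]
    constructor
    · rintro ⟨y, hy, hyx⟩
      have hwx : w ≠ x := by
        rintro rfl
        rw [hx] at hy
        exact hyx (Option.some.inj hy).symm
      obtain ⟨v, hv⟩ := Option.isSome_iff_exists.1 ((hd x w).2 hwx)
      refine ⟨v, hv, fun h => ?_⟩
      rw [h] at hv
      have := (c x).inj hv (hz.step i hi)
      rw [this, hnone] at hy
      cases hy
    · rintro ⟨y, hy, hyz⟩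
      have hwz : w ≠ z i := by
        rintro rfl
        rw [hz.step i hi] at hy
        exact hyz (Option.some.inj hy).symm
      obtain ⟨v, hv⟩ := Option.isSome_iff_exists.1 ((hd (z i) w).2 hwz)
      refine ⟨v, hv, fun h => ?_⟩
      rw [h] at hv
      rw [(c (z i)).inj hv hx, hnone] at hy
      cases hy
  -- Descending induction on the index `i = r - k`. At `z l`, `hcomm` says that `c x` sends the
  -- value of `c (z i)` to the value of `c (z (i + 1))` at `z (l + 1)`. The latter is `z (l + 2)`,
  -- which is also the value of `c x` at `z (l + 1)`.
  have hstep : ∀ k ≤ r, ∀ l < r - k, c (z (r - k)) (z l) = some (z (l + 1)) := by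
    intro k
    induction k with
    | zero =>
      intro _ l hl
      rw [Nat.sub_zero, hz.last]
      exact hz.step l hl
    | succ k ih =>
      intro hk l hl
      obtain ⟨v, hv⟩ := Option.isSome_iff_exists.1 ((hd (z (r - (k + 1))) (z l)).2 fun h => by
        have := hinj l (by omega) _ (by omega) h
        omega)
      have h1 := DFunLike.congr_fun (hcomm (r - (k + 1)) (by omega)) (z l)
      rw [IS.mul_apply, IS.mul_apply, hv, hz.step l (by omega), Option.bind_some, Option.bind_some,
        show r - (k + 1) + 1 = r - k by omega, ih (by omega) (l + 1) (by omega)] at h1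
      rw [hv, (c x).inj h1 (hz.step (l + 1) (by omega))]
  refine ⟨r, z, hz.last, fun i hi => ⟨fun l hl => ?_, hnone _, hfix i hi⟩⟩
  have := hstep (r - i) (by omega) l (by omega)
  rwa [show r - (r - i) = i by omega] at this

/-- A pair of functions that is injective, the second of which is bounded by the sizes of the
fibres of the first one, comes from an ordered decomposition. -/
theorem OrderedDecomposition.exists_of_injective {n : ℕ} (τ : Fin n → Fin n) (l : Fin n → ℕ)
    (hinj : ∀ x y, τ x = τ y → l x = l y → x = y)
    (hl : ∀ x, l x < Nat.card {y // τ y = τ x}) :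
    ∃ D : OrderedDecomposition n,
      (∀ x y, (D.elt.symm x).1 = (D.elt.symm y).1 ↔ τ x = τ y) ∧
      ∀ x, ((D.elt.symm x).2 : ℕ) = l x := by
  classical
  let Y := Set.range τ
  let idx : Fin (Nat.card Y) ≃ Y := (Finite.equivFin Y).symm
  let size : Fin (Nat.card Y) → ℕ := fun i => Nat.card {y // τ y = idx i}
  let G : Fin n → Σ i, Fin (size i) := fun x =>
    ⟨idx.symm ⟨τ x, x, rfl⟩, ⟨l x, by
      simp only [size, Equiv.apply_symm_apply]
      exact hl x⟩⟩
  have hG1 : ∀ x y, (G x).1 = (G y).1 ↔ τ x = τ y := by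
    intro x y
    exact idx.symm.injective.eq_iff.trans Subtype.mk_eq_mk
  have hGinj : Function.Injective G := by
    intro x y h
    refine hinj x y ((hG1 x y).1 (by rw [h])) ?_
    have : ∀ p q : Σ i, Fin (size i), p = q → (p.2 : ℕ) = q.2 := by
      rintro p _ rfl
      rfl
    exact this _ _ h
  -- The block sizes are the cardinalities of the fibres of `τ` and add up to `n`, so injectivity of
  -- `G` suffices for bijectivity.
  have hcard : Nat.card (Σ i, Fin (size i)) = Nat.card (Fin n) := by
    let e : (Σ i, {y // τ y = idx i}) ≃ Fin n :=
      (Equiv.sigmaCongrLeft' (β := fun i => {y // τ y = idx i}) idx).trans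
        ((Equiv.sigmaCongrRight fun y => Equiv.subtypeEquivRight fun x => by
          rw [Equiv.apply_symm_apply, Subtype.ext_iff]).trans
          (Equiv.sigmaFiberEquiv fun x => (⟨τ x, x, rfl⟩ : Y)))
    rw [← Nat.card_congr e]
    simp [size]
  have hGbij : Function.Bijective G := by
    have := Fintype.ofFinite (Σ i, Fin (size i))
    rw [Fintype.bijective_iff_injective_and_card]
    refine ⟨hGinj, ?_⟩
    rw [← Nat.card_eq_fintype_card, ← Nat.card_eq_fintype_card, hcard]
  refine ⟨⟨Nat.card Y, size, fun i => ?_, (Equiv.ofBijective G hGbij).symm⟩, hG1, fun x => rfl⟩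
  obtain ⟨x, hx⟩ := (idx i).2
  exact Nat.card_pos_iff.2 ⟨⟨⟨x, hx⟩⟩, inferInstance⟩

theorem OrderedDecomposition.blockChain_eq {n : ℕ} (D : OrderedDecomposition n) {x : Fin n}
    {a : IS (Fin n)} {r : ℕ} {z : ℕ → Fin n} (ha : IsChainMap a r z) (hr : z r = x)
    (hz : ∀ i ≤ r, (D.elt.symm (z i)).1 = (D.elt.symm x).1 ∧ ((D.elt.symm (z i)).2 : ℕ) = i) :
    D.blockChain (D.elt.symm x) = a := by
  subst hr
  have hzr := (hz r le_rfl).2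
  obtain ⟨⟨i, j⟩, hij⟩ : ∃ q, z r = D.elt q := ⟨_, (D.elt.apply_symm_apply _).symm⟩
  rw [hij, Equiv.symm_apply_apply] at hzr hz
  rw [hij, Equiv.symm_apply_apply]
  obtain rfl : (j : ℕ) = r := hzr
  have hmem : ∀ p : Fin (D.size i), p ≤ j → z p = D.elt ⟨i, p⟩ := by
    intro p hp
    obtain ⟨h1, h2⟩ := hz p hp
    obtain ⟨⟨i', p'⟩, hq⟩ : ∃ q, z p = D.elt q := ⟨_, (D.elt.apply_symm_apply _).symm⟩
    rw [hq, Equiv.symm_apply_apply] at h1 h2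
    obtain rfl : i' = i := h1
    rw [hq, show p' = p from Fin.ext h2]
  refine PEquiv.ext fun w => ?_
  obtain ⟨⟨i', p⟩, rfl⟩ := D.elt.surjective w
  have hfix : (¬ ∃ h : i' = i, h ▸ p ≤ j) → a (D.elt ⟨i', p⟩) = some (D.elt ⟨i', p⟩) := by
    intro hno
    refine ha.fixed _ fun m hm h => hno ?_
    have h3 := hmem ⟨m, by omega⟩ hm
    rw [← h] at h3
    have h4 := D.elt.injective h3
    obtain rfl : i' = i := congrArg Sigma.fst h4
    exact ⟨rfl, (Fin.ext_iff.1 (eq_of_heq (Sigma.mk.inj h4).2)).trans_le hm⟩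
  by_cases hi : i' = i
  · subst hi
    rw [blockChain_elt]
    rcases lt_trichotomy p j with h | rfl | h
    · have hs := ha.step p h
      have h1 := hmem ⟨p + 1, by omega⟩ h
      simp only at h1
      rw [hmem p h.le, h1] at hs
      rw [hs, chain_of_lt (y := ⟨p + 1, by omega⟩) h rfl]
      rfl
    · rw [chain_self, ← hij, ha.last]
      rfl
    · rw [chain_of_gt h, hfix]
      · rfl
      · exact fun h' => absurd (show p ≤ j from h'.choose_spec) (not_le.2 h)
  · rw [blockChain_elt_of_ne _ hi, hfix]
    rintro ⟨h, -⟩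
    exact hi h

/-- The chains of the various points must fit together: two of them with the same start are initial
segments of one another. The start of the path to `x` then names the block of `x`, its length the
position of `x`. -/
theorem IsCrossSection.exists_eq_symmSection_R {n : ℕ} {C : Subsemigroup (IS (Fin n))}
    (hC : IsCrossSection .R C) : ∃ D : OrderedDecomposition n, C = D.symmSection .R := by
  have hex : ∀ x, ∃ c ∈ C, ∀ y, (c y).isSome ↔ y ≠ x := by
    intro x
    obtain ⟨c, hc, h⟩ := hC.exists_rel (PEquiv.ofSet {y | y ≠ x})
    refine ⟨c, hc, fun y => ?_⟩
    rw [IS.rel_R_iff] at h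
    rw [h y]
    by_cases hy : y = x <;> simp [PEquiv.ofSet, hy]
  choose c hc hd using hex
  choose l z hz hch using hC.exists_isChain hc hd
  have huniq : ∀ x, ∀ i ≤ l x, l (z x i) = i ∧ ∀ j ≤ i, z (z x i) j = z x j := by
    intro x i hi
    have h1 := (hch (z x i) (l (z x i)) le_rfl).isMaxPath
    have h2 := (hch x i hi).isMaxPath
    rw [hz] at h1
    obtain ⟨h3, h4⟩ := h2.unique h1
    exact ⟨h3.symm, fun j hj => (h4 j hj).symm⟩
  -- Suppose that two paths part after the vertex `z k`, towards `p` and `q`. Then `c p` fixes `q`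
  -- and `c q` fixes `p`, so `c p * c q` and `c q * c p` have the same domain and coincide. But they
  -- send `z k` to `p` and to `q` respectively.
  have hagree : ∀ x y, z x 0 = z y 0 → ∀ i, i ≤ l x → i ≤ l y → z x i = z y i := by
    intro x y h0 i
    induction i using Nat.strong_induction_on with
    | _ i ih =>
      intro hx hy
      rcases Nat.eq_zero_or_pos i with rfl | hi
      · exact h0
      obtain ⟨k, rfl⟩ : ∃ k, i = k + 1 := ⟨i - 1, by omega⟩
      by_contra hne
      have h1 : ∀ j ≤ k, z x j = z y j := fun j hj => ih j (by omega) (by omega) (by omega)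
      have hp := hch x (k + 1) hx
      have hq := hch y (k + 1) hy
      have hpq : c (z x (k + 1)) (z y (k + 1)) = some (z y (k + 1)) := by
        refine hp.fixed _ fun j hj h => ?_
        rcases Nat.lt_or_ge k j with hkj | hkj
        · rw [show j = k + 1 by omega] at h
          exact hne h.symm
        · rw [h1 j hkj] at h
          have := hq.injOn _ le_rfl j hj h
          omega
      have hqp : c (z y (k + 1)) (z x (k + 1)) = some (z x (k + 1)) := by
        refine hq.fixed _ fun j hj h => ?_
        rcases Nat.lt_or_ge k j with hkj | hkj
        · rw [show j = k + 1 by omega] at h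
          exact hne h
        · rw [← h1 j hkj] at h
          have := hp.injOn _ le_rfl j hj h
          omega
      have key : ∀ p q : Fin n, c p q = some q → c q p = some p → ∀ w,
          ((c p * c q) w).isSome → ((c q * c p) w).isSome := by
        intro p q hpq hqp w
        simp only [IS.isSome_mul, hd]
        rintro ⟨v, hv, hvq⟩
        have hwq : w ≠ q := by
          rintro rfl
          rw [hpq] at hv
          exact hvq (Option.some.inj hv).symm
        obtain ⟨u, hu⟩ := Option.isSome_iff_exists.1 ((hd q w).2 hwq)
        refine ⟨u, hu, fun h => ?_⟩
        rw [h] at hu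
        rw [(c q).inj hu hqp] at hv
        have := (hd p p).1 (by rw [hv]; rfl)
        exact this rfl
      have hcomm : c (z x (k + 1)) * c (z y (k + 1)) = c (z y (k + 1)) * c (z x (k + 1)) :=
        hC.eq_of_isSome (C.mul_mem (hc _) (hc _)) (C.mul_mem (hc _) (hc _)) fun w =>
          ⟨key _ _ hpq hqp w, key _ _ hqp hpq w⟩
      have h2 := DFunLike.congr_fun hcomm (z x k)
      have h3 := hq.step k (by omega)
      rw [← h1 k le_rfl] at h3
      rw [IS.mul_apply, IS.mul_apply, hp.step k (by omega), h3, Option.bind_some, Option.bind_some,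
        hpq, hqp] at h2
      exact hne (Option.some.inj h2)
  obtain ⟨D, hD1, hD2⟩ := OrderedDecomposition.exists_of_injective (fun x => z x 0) l
    (fun x y h hl => by
      have := hagree x y h (l x) le_rfl hl.le
      rw [hz, hl, hz] at this
      exact this)
    -- The `l x + 1` points of the path to `x` are distinct and have the same start.
    (fun x => by
      have hinj : Function.Injective fun i : Fin (l x + 1) =>
          (⟨z x i, (huniq x i (by omega)).2 0 (Nat.zero_le _)⟩ : {y // z y 0 = z x 0}) :=
        fun i j h => Fin.ext ((hch x (l x) le_rfl).injOn i (by omega) j (by omega)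
          (congrArg Subtype.val h))
      have := Nat.card_le_card_of_injective _ hinj
      rw [Nat.card_fin] at this
      omega)
  refine ⟨D, (D.isCrossSection_symmSection_R.eq_of_le hC ?_).symm⟩
  refine Subsemigroup.closure_le.2 ?_
  rintro _ (rfl | ⟨q, rfl⟩)
  · exact hC.ident_mem
  · obtain ⟨x, rfl⟩ : ∃ x, q = D.elt.symm x := ⟨_, (D.elt.symm_apply_apply q).symm⟩
    have h := hch x (l x) le_rfl
    rw [hz] at h
    rw [D.blockChain_eq h (hz x) fun i hi =>
      ⟨(hD1 _ _).2 ((huniq x i hi).2 0 (Nat.zero_le _)), (hD2 _).trans (huniq x i hi).1⟩]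
    exact hc x

theorem IsCrossSection.exists_eq_symmSection {n : ℕ} {g : Green} {C : Subsemigroup (IS (Fin n))}
    (hC : IsCrossSection g C) : ∃ D : OrderedDecomposition n, C = D.symmSection g := by
  cases g
  · exact hC.exists_eq_symmSection_R
  · obtain ⟨D, hD⟩ := (isCrossSection_L_iff.1 hC).exists_eq_symmSection_R
    exact ⟨D, by rw [D.symmSection_L, ← hD, inverted_inverted]⟩

end Classification

/-! ### Products are cross-sections -/

namespace OrderedDecomposition

variable {n : ℕ} (D : OrderedDecomposition n) {S : Type*} [Semigroup S]

theorem glueHom_f_elt (u : ∀ i, PWr S (Fin (D.size i))) (i : Fin D.k) (p : Fin (D.size i)) :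
    (D.glueHom S u).f (D.elt ⟨i, p⟩) = (u i).f p := by
  change (u (D.elt.symm (D.elt ⟨i, p⟩)).1).f (D.elt.symm (D.elt ⟨i, p⟩)).2 = _
  rw [Equiv.symm_apply_apply]

theorem glueHom_a (u : ∀ i, PWr S (Fin (D.size i))) :
    (D.glueHom S u).a = D.glue fun i => (u i).a := rfl

theorem glue_injective : Function.Injective D.glue := by
  intro a b h
  funext i
  refine PEquiv.ext fun p => ?_
  have := DFunLike.congr_fun h (D.elt ⟨i, p⟩)
  rw [glue_elt, glue_elt] at this
  refine Option.map_injective ?_ this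
  intro q q' hq
  simpa using hq

theorem glueHom_injective : Function.Injective (D.glueHom S) := by
  intro u v h
  funext i
  refine PWr.ext (funext fun p => ?_) (congrFun (D.glue_injective (congrArg PWr.a h)) i)
  rw [← glueHom_f_elt, h, glueHom_f_elt]

theorem productHom_apply (g : Green) (T : Fin D.k → Subsemigroup S) (u : D.Product g T) :
    D.productHom g T u = D.glueHom S fun i => (u i : PWr S (Fin (D.size i))) := rfl

theorem productHom_injective (g : Green) (T : Fin D.k → Subsemigroup S) :
    Function.Injective (D.productHom g T) := by
  intro u v h
  rw [productHom_apply, productHom_apply] at h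
  have := D.glueHom_injective h
  funext i
  exact Subtype.ext (congrFun this i)

/-- A product is isomorphic to its realisation inside `S ≀ IS n`. -/
theorem nonempty_srange_mulEquiv (g : Green) (T : Fin D.k → Subsemigroup S) :
    Nonempty ((D.productHom g T).srange ≃* D.Product g T) := by
  let e : D.Product g T ≃* (D.productHom g T).srange :=
    MulEquiv.ofBijective (D.productHom g T).srangeRestrict
      ⟨fun u v h => D.productHom_injective g T (congrArg Subtype.val h),
        MulHom.srangeRestrict_surjective _⟩
  exact ⟨e.symm⟩

theorem mem_srange_productHom_R {T : Fin D.k → Subsemigroup S} {u : PWr S (Fin n)} :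
    u ∈ (D.productHom .R T).srange ↔
      (∀ i p s, u.f (D.elt ⟨i, p⟩) = some s → s ∈ T i) ∧ u.a ∈ D.symmSection .R := by
  constructor
  · rintro ⟨w, rfl⟩
    constructor
    · intro i p s hs
      have : ((w i : PWr S _)).f p = some s := by
        rw [← hs]
        exact (D.glueHom_f_elt (fun i => (w i : PWr S _)) i p).symm
      exact (w i).2.1 p s this
    · rw [← glueSection_eq]
      exact ⟨_, fun i => (w i).2.2, rfl⟩
  · rintro ⟨h1, h2⟩
    rw [← glueSection_eq] at h2
    obtain ⟨b, hb, h⟩ := h2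
    let w : ∀ i, PWr S (Fin (D.size i)) := fun i =>
      { f := fun p => u.f (D.elt ⟨i, p⟩)
        a := b i
        dom := fun p => by rw [u.dom, ← h, glue_isSome] }
    refine ⟨fun i => ⟨w i, fun p s hs => h1 i p s hs, hb i⟩, PWr.ext (funext fun x => ?_) h⟩
    obtain ⟨⟨i, p⟩, rfl⟩ := D.elt.surjective x
    exact D.glueHom_f_elt w i p

variable [UnitalInverse S]

/-- An R-class is a domain with an R-class for each entry, so representatives can be chosen
independently: the second coordinate in `R(M₁, …, M_k)`, the entries over the block `M i` in `T i`.
-/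
theorem isCrossSection_srange_R {T : Fin D.k → Subsemigroup S}
    (hT : ∀ i, IsCrossSection .R (T i)) : IsCrossSection .R (D.productHom .R T).srange := by
  have hsymm := D.isCrossSection_symmSection_R
  refine isCrossSection_of (fun u => ?_) fun u hu v hv h => ?_
  · choose rep hrep1 hrep2 using fun i s => (hT i).exists_rel s
    obtain ⟨a, ha, hau⟩ := hsymm.exists_rel u.a
    rw [IS.rel_R_iff] at hau
    refine ⟨⟨fun x => (u.f x).map (rep (D.elt.symm x).1), a, fun x => ?_⟩, ?_, ?_⟩
    · rw [Option.isSome_map, u.dom, hau]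
    · rw [mem_srange_productHom_R]
      refine ⟨fun i p s hs => ?_, ha⟩
      simp only [Equiv.symm_apply_apply, Option.map_eq_some_iff] at hs
      obtain ⟨t, -, rfl⟩ := hs
      exact hrep1 i t
    · rw [PWr.rel_R_iff]
      intro x
      change ((u.f x).map _).map src = _
      cases u.f x with
      | none => rfl
      | some s => exact congrArg some (rel_R_iff.1 (hrep2 _ s))
  · rw [mem_srange_productHom_R] at hu hv
    rw [PWr.rel_R_iff] at h
    refine PWr.ext (funext fun x => ?_) (hsymm.eq_of_rel hu.2 hv.2 (IS.rel_R_iff.2 fun x => ?_))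
    · obtain ⟨⟨i, p⟩, rfl⟩ := D.elt.surjective x
      have := h (D.elt ⟨i, p⟩)
      cases h1 : u.f (D.elt ⟨i, p⟩) with
      | none => rw [h1] at this; simpa [eq_comm] using this
      | some s =>
        rw [h1, Option.map_some, eq_comm, Option.map_eq_some_iff] at this
        obtain ⟨t, ht, hts⟩ := this
        rw [ht, (hT i).eq_of_rel (hv.1 i p t ht) (hu.1 i p s h1) (rel_R_iff.2 hts)]
    · rw [← u.dom, ← v.dom, ← Option.isSome_map (f := src), h x, Option.isSome_map]

theorem invert_glueHom (u : ∀ i, PWr S (Fin (D.size i))) :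
    invert (D.glueHom S u) = D.glueHom S fun i => invert (u i) := by
  refine PWr.ext (funext fun y => ?_) (D.glue_symm _)
  obtain ⟨⟨i, q⟩, rfl⟩ := D.elt.surjective y
  rw [glueHom_f_elt]
  change ((D.glueHom S u).a.symm (D.elt ⟨i, q⟩)).bind _ = ((u i).a.symm q).bind _
  rw [glueHom_a, glue_symm, glue_elt]
  cases (u i).a.symm q with
  | none => rfl
  | some p =>
    simp only [Option.map_some, Option.bind_some]
    rw [glueHom_f_elt]

theorem invert_mem_pwr {X : Type*} {T : Subsemigroup S} {P : Subsemigroup (IS X)} {u : PWr S X}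
    (hu : u ∈ pwr T P) : invert u ∈ pwr (inverted T) (invSubsemigroup P) := by
  refine ⟨fun y s hs => ?_, hu.2⟩
  change (u.a.symm y).bind (fun x => (u.f x).map invert) = some s at hs
  simp only [Option.bind_eq_some_iff, Option.map_eq_some_iff] at hs
  obtain ⟨x, -, t, ht, rfl⟩ := hs
  rw [mem_inverted, invert_invert]
  exact hu.1 x t ht

/-- Inversion acts block by block, inverting the entries and exchanging `R(M i)` with `L(M i)`. This
carries the results for R over to L. -/
theorem srange_productHom_L (T : Fin D.k → Subsemigroup S) :
    (D.productHom .L T).srange = inverted (D.productHom .R fun i => inverted (T i)).srange := by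
  ext u
  constructor
  · rintro ⟨w, rfl⟩
    refine ⟨fun i => ⟨_, invert_mem_pwr (w i).2⟩, ?_⟩
    rw [productHom_apply, productHom_apply, invert_glueHom]
  · rintro ⟨w, hw⟩
    refine ⟨fun i => ⟨invert (w i : PWr S _), ?_⟩, ?_⟩
    · have := invert_mem_pwr (w i).2
      rwa [inverted_inverted] at this
    · rw [← invert_invert u, ← hw, productHom_apply, productHom_apply, invert_glueHom]

theorem isCrossSection_srange {g : Green} {T : Fin D.k → Subsemigroup S}
    (hT : ∀ i, IsCrossSection g (T i)) : IsCrossSection g (D.productHom g T).srange := by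
  cases g
  · exact D.isCrossSection_srange_R hT
  · rw [srange_productHom_L, isCrossSection_L_iff, inverted_inverted]
    exact D.isCrossSection_srange_R fun i => isCrossSection_L_iff.1 (hT i)

end OrderedDecomposition

/-! ### Classification of the cross-sections of a partial wreath product -/

namespace PWr

variable {S X : Type*}

theorem ext_of_base {u : PWr S X} {f : X → S} (hf : ∀ x, u.f x = some (f x)) (ha : u.a = 1) :
    u = base f := PWr.ext (funext hf) ha

variable [Semigroup S]

/-- Take a power `p` of `c` with `p c = p`. It is total, hence surjective on the finite set `X`, and
`c` fixes every point of its image. -/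
theorem a_eq_one [Finite S] [Finite X] {C : Subsemigroup (PWr S X)} (hC : IsCrossSection .R C) {c : PWr S X} (hc : c ∈ C)
    (hd : ∀ x, (c.a x).isSome) : c.a = 1 := by
  obtain ⟨p, hp, hpc⟩ := hC.exists_mul_eq_self hc
  let Q : Subsemigroup (PWr S X) :=
    { carrier := {u | ∀ x, (u.a x).isSome}
      mul_mem' := by
        intro u v hu hv x
        obtain ⟨y, hy⟩ := Option.isSome_iff_exists.1 (hu x)
        rw [mul_a_of_eq hy]
        exact hv y }
  have hQ : Subsemigroup.closure {c} ≤ Q := by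
    rw [Subsemigroup.closure_le, Set.singleton_subset_iff]
    exact hd
  have hp' : ∀ x, (p.a x).isSome := hQ hp
  have hinj : Function.Injective fun x => (p.a x).get (hp' x) := by
    intro x y h
    refine p.a.inj (Option.some_get (hp' x)).symm ?_
    exact (Option.some_get (hp' y)).symm.trans (congrArg some h.symm)
  refine PEquiv.ext fun x => ?_
  obtain ⟨y, hy⟩ := Finite.surjective_of_injective hinj x
  have hy : p.a y = some x := by rw [← hy, Option.some_get]
  rw [← mul_a_of_eq (v := c) hy, hpc, hy]
  rfl

variable [UnitalInverse S]

/-- The element `(1, a)` of a partial wreath product. -/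
def lift (a : IS X) : PWr S X where
  f x := (a x).map fun _ => ident
  a := a
  dom _ := Option.isSome_map

theorem lift_mul (a b : IS X) : (lift (a * b) : PWr S X) = lift a * lift b := by
  refine PWr.ext (funext fun x => ?_) rfl
  rw [mul_f]
  change ((a * b) x).map _ = ((a x).map _).bind fun s => (a x).bind fun y => ((b y).map _).map _
  rw [IS.mul_apply]
  cases a x with
  | none => rfl
  | some y => cases h : b y <;> simp [h]

theorem lift_f_of_eq {a : IS X} {x y : X} (h : a x = some y) :
    (lift a : PWr S X).f x = some ident := by
  change (a x).map _ = _
  rw [h]; rfl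

theorem base_mul_lift {u : PWr S X} {f : X → S} (h : ∀ x s, u.f x = some s → f x = s) :
    base f * lift u.a = u := by
  refine PWr.ext (funext fun x => ?_) (base_mul_a _ _)
  rw [base_mul_f]
  rcases u.cases_eq x with ⟨h1, h2⟩ | ⟨s, y, h1, h2⟩
  · change ((u.a x).map _).map _ = _
    rw [h1, h2]; rfl
  · rw [lift_f_of_eq h2, h1, Option.map_some, mul_ident, h x s h1]

/-- The element of a partial wreath product that acts as `s` at `x` and as the identity
elsewhere. -/
noncomputable def single (x : X) (s : S) : PWr S X :=
  open Classical in base (Function.update (fun _ => ident) x s)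

theorem single_mul_single (x : X) (s t : S) : single x s * single x t = single x (s * t) := by
  classical
  unfold single
  rw [base_mul_base]
  congr 1
  funext y
  by_cases h : y = x
  · subst h
    simp
  · simp [Function.update_of_ne h]

theorem single_mul_f_self {x : X} {s t : S} {u : PWr S X} (h : u.f x = some t) :
    (single x s * u).f x = some (s * t) := by
  classical
  unfold single
  rw [base_mul_f, h, Function.update_self]
  rfl

theorem single_mul_f_of_ne {x y : X} {s : S} {u : PWr S X} (h : y ≠ x) :
    (single x s * u).f y = u.f y := by
  classical
  unfold single
  rw [base_mul_f, Function.update_of_ne h]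
  simp

theorem mul_single_f_self {x y : X} {s t : S} {u : PWr S X} (h : u.f x = some t)
    (h' : u.a x = some y) : (u * single y s).f x = some (t * s) := by
  classical
  unfold single
  rw [mul_f_of_eq h h']
  simp [base]

theorem mul_single_f_of_ne {x y : X} {s : S} {u : PWr S X} (h : u.a x ≠ some y) :
    (u * single y s).f x = u.f x := by
  classical
  rcases u.cases_eq x with ⟨h1, h2⟩ | ⟨t, y', h1, h2⟩
  · rw [mul_f_of_none _ h1, h1]
  · rw [mul_f_of_eq h1 h2, h1]
    unfold single base
    rw [h2] at h
    simp only [Option.map_some]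
    rw [Function.update_of_ne fun h3 => h (congrArg some h3), mul_ident]

/-- The elements of a subsemigroup of a partial wreath product that act at one point `x` only. -/
def component (C : Subsemigroup (PWr S X)) (x : X) : Subsemigroup S where
  carrier := {s | single x s ∈ C}
  mul_mem' := by
    intro s t hs ht
    change single x (s * t) ∈ C
    rw [← single_mul_single]
    exact C.mul_mem hs ht

theorem mem_component {C : Subsemigroup (PWr S X)} {x : X} {s : S} :
    s ∈ component C x ↔ single x s ∈ C := Iff.rfl

/-- The elements of a subsemigroup of a partial wreath product all of whose entries are units. -/
def unitPart (C : Subsemigroup (PWr S X)) : Subsemigroup (PWr S X) where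
  carrier := {u | u ∈ C ∧ ∀ x s, u.f x = some s → src s = ident}
  mul_mem' := by
    rintro u v ⟨hu, hu'⟩ ⟨hv, hv'⟩
    refine ⟨C.mul_mem hu hv, fun x s hs => ?_⟩
    rw [mul_f] at hs
    simp only [Option.bind_eq_some_iff, Option.map_eq_some_iff] at hs
    obtain ⟨p, hp, y, -, t, ht, rfl⟩ := hs
    exact src_eq_ident_mul (hu' x p hp) (hv' y t ht)

/-- Unit entries are all R-related to the identity, so nothing but the domain is left of the
R-class. -/
theorem unitPart_eq {C : Subsemigroup (PWr S X)} (hC : IsCrossSection .R C) {u v : PWr S X} (hu : u ∈ unitPart C)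
    (hv : v ∈ unitPart C) (h : ∀ x, (u.a x).isSome = (v.a x).isSome) : u = v := by
  refine hC.eq_of_rel hu.1 hv.1 (rel_R_iff.2 fun x => ?_)
  have := h x
  rw [← u.dom, ← v.dom] at this
  cases h1 : u.f x <;> cases h2 : v.f x <;> simp_all [hu.2 x, hv.2 x]

/-- The projection of a partial wreath product to its second factor. -/
def proj {S X : Type*} [Semigroup S] : PWr S X →ₙ* IS X where
  toFun := PWr.a
  map_mul' _ _ := rfl

/-- The R-class of `lift a` consists of the elements with the domain of `a` and all entries
R-related to the identity. Its representative in `C` thus lies in `unitPart C`. -/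
theorem isCrossSection_map_proj {C : Subsemigroup (PWr S X)} (hC : IsCrossSection .R C) :
    IsCrossSection .R ((unitPart C).map proj) := by
  refine isCrossSection_of (fun a => ?_) ?_
  · obtain ⟨c, hc, h⟩ := hC.exists_rel (lift a)
    rw [rel_R_iff] at h
    refine ⟨c.a, ⟨c, ⟨hc, fun x s hs => ?_⟩, rfl⟩, IS.rel_R_iff.2 fun x => ?_⟩
    · have := h x
      rw [hs] at this
      change some (src s) = ((a x).map _).map src at this
      cases hx : a x with
      | none => rw [hx] at this; cases this
      | some y =>
        rw [hx] at this
        exact (Option.some.inj this).trans src_ident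
    · rw [← c.dom, ← Option.isSome_map (f := src), h x, Option.isSome_map, (lift a).dom]
      rfl
  · rintro _ ⟨u, hu, rfl⟩ _ ⟨v, hv, rfl⟩ h
    rw [unitPart_eq hC hu hv (IS.rel_R_iff.1 h)]

/-! ### Rigidity of cross-sections over a finite semigroup -/

variable [Finite S] [Finite X] {C : Subsemigroup (PWr S X)}

/-- Take a power `p` of `c` with `p c = p`. It also fixes `x` and has a unit entry `t` there, so `t
s = t`, and `t` cancels. -/
theorem eq_ident_of_fixed (hC : IsCrossSection .R C) {c : PWr S X} (hc : c ∈ C) {x : X} {s : S}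
    (hx : c.a x = some x) (hs : c.f x = some s) (hu : src s = ident) : s = ident := by
  obtain ⟨p, hp, hpc⟩ := hC.exists_mul_eq_self hc
  let Q : Subsemigroup (PWr S X) :=
    { carrier := {u | u.a x = some x ∧ ∃ t, u.f x = some t ∧ src t = ident}
      mul_mem' := by
        rintro u v ⟨hu, t, ht, ht'⟩ ⟨hv, r, hr, hr'⟩
        exact ⟨by rw [mul_a_of_eq hu, hv], t * r, by rw [mul_f_of_eq ht hu, hr]; rfl,
          src_eq_ident_mul ht' hr'⟩ }
  have hQ : Subsemigroup.closure {c} ≤ Q := by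
    rw [Subsemigroup.closure_le, Set.singleton_subset_iff]
    exact ⟨hx, s, hs, hu⟩
  obtain ⟨h1, t, ht, ht'⟩ := hQ hp
  have h2 : (p * c).f x = some (t * s) := by rw [mul_f_of_eq ht h1, hs]; rfl
  rw [hpc, ht] at h2
  have h3 := congrArg (invert t * ·) (Option.some.inj h2)
  simpa [← mul_assoc, invert_mul_self_of_src ht'] using h3.symm

/-- The representative in `C` of `single x s` has trivial second coordinate by `a_eq_one`. Away from
`x` its entries are units at fixed points, hence trivial, so it is again of the form `single x t`.
-/
theorem isCrossSection_component (hC : IsCrossSection .R C) (x : X) :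
    IsCrossSection .R (component C x) := by
  classical
  refine isCrossSection_of (fun s => ?_) fun s hs t ht h => ?_
  · obtain ⟨c, hc, h⟩ := hC.exists_rel (single x s)
    rw [rel_R_iff] at h
    have h' : ∀ y, ∃ t, c.f y = some t ∧ src t = src (Function.update (fun _ : X => (ident : S)) x s y) := by
      intro y
      have := h y
      simpa [single, base] using this
    have ha : c.a = 1 := a_eq_one hC hc fun y => by
      obtain ⟨t, ht, -⟩ := h' y
      rw [← c.dom, ht]; rfl
    obtain ⟨t, ht, hts⟩ := h' x
    rw [Function.update_self] at hts
    refine ⟨t, ?_, UnitalInverse.rel_R_iff.2 hts⟩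
    rw [mem_component, single, ← ext_of_base (u := c) (fun y => ?_) ha]
    · exact hc
    · by_cases hy : y = x
      · subst hy
        rw [ht, Function.update_self]
      · obtain ⟨r, hr, hr'⟩ := h' y
        rw [Function.update_of_ne hy] at hr' ⊢
        rw [hr, eq_ident_of_fixed hC hc (by rw [ha]; rfl) hr (hr'.trans src_ident)]
  · have h1 : single x s = single x t := by
      refine hC.eq_of_rel hs ht (rel_R_iff.2 fun y => ?_)
      rw [UnitalInverse.rel_R_iff] at h
      by_cases hy : y = x
      · subst hy
        simp [single, base, h]
      · simp [single, base, Function.update_of_ne hy]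
    have h2 := congrFun (congrArg PWr.f h1) x
    simpa [single, base] using h2

theorem base_mem (hC : IsCrossSection .R C) {f : X → S} (hf : ∀ x, f x ∈ component C x) :
    base f ∈ C := by
  classical
  have := Fintype.ofFinite X
  have key : ∀ F : Finset X, base (F.piecewise f fun _ => ident) ∈ C := by
    intro F
    induction F using Finset.induction_on with
    | empty =>
      rw [Finset.piecewise_empty]
      exact hC.ident_mem
    | insert x F hx ih =>
      have := C.mul_mem (mem_component.1 (hf x)) ih
      rw [single, base_mul_base] at this
      convert this using 2
      funext y
      by_cases hy : y = x
      · subst hy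
        simp [hx]
      · simp [hy, Finset.piecewise, Finset.mem_insert]
  simpa using key Finset.univ

/-- Let `t'` be the representative of `g⁻¹ t` in the component at `y`. Then `single x t * c` and `c
* single y t'` are R-related elements of `C`, hence equal, and their entries at `x` give `t g = g
t'`. -/
theorem conj_mem_component (hC : IsCrossSection .R C) {c : PWr S X} (hc : c ∈ unitPart C)
    {x y : X} {g t : S} (hy : c.a x = some y) (hg : c.f x = some g) (ht : t ∈ component C x) :
    invert g * t * g ∈ component C y := by
  have hgu : g * invert g = ident := hc.2 x g hg
  have hgu' : invert g * g = ident := invert_mul_self_of_src hgu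
  obtain ⟨t', ht', h⟩ := (isCrossSection_component hC y).exists_rel (invert g * t)
  rw [UnitalInverse.rel_R_iff] at h
  have key : single x t * c = c * single y t' := by
    refine hC.eq_of_rel (C.mul_mem ht hc.1) (C.mul_mem hc.1 ht') (rel_R_iff.2 fun w => ?_)
    by_cases hw : w = x
    · subst hw
      rw [single_mul_f_self hg, mul_single_f_self hg hy, Option.map_some, Option.map_some]
      congr 1
      rw [src_mul_of_src_eq_ident t hgu]
      have : src (g * t') = g * src t' * invert g := by simp [src, mul_assoc]
      rw [this, h]
      unfold src
      rw [invert_mul, invert_invert, ← mul_assoc, ← mul_assoc, ← mul_assoc, hgu, ident_mul,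
        mul_assoc, hgu, mul_ident]
    · rw [single_mul_f_of_ne hw, mul_single_f_of_ne fun h => hw (c.a.inj h hy)]
  have h1 := congrFun (congrArg PWr.f key) x
  rw [single_mul_f_self hg, mul_single_f_self hg hy] at h1
  rw [mul_assoc, Option.some.inj h1, ← mul_assoc, hgu', ident_mul]
  exact ht'

/-- Along a block of the decomposition the unit entries of a cross-section are a coboundary. -/
theorem exists_coboundary (hC : IsCrossSection .R C) {r : ℕ} {z : ℕ → X} {c : ℕ → PWr S X}
    (hz : ∀ i < r, ∀ j < r, z i = z j → i = j)
    (hc : ∀ j < r, c j ∈ unitPart C) (hch : ∀ j < r, IsChainMap (c j).a j z) :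
    ∃ h : ℕ → S, (∀ j < r, src (h j) = ident) ∧
      (∀ j < r, ∀ l < j, (c j).f (z l) = some (invert (h l) * h (l + 1))) ∧
      ∀ t ∈ component C (z 0), ∀ j < r, invert (h j) * t * h j ∈ component C (z j) := by
  -- The default value is never met for `l < m < r`, where `c m` is defined at `z l`.
  let F : ℕ → ℕ → S := fun m l => ((c m).f (z l)).getD ident
  have hF : ∀ m < r, ∀ l < m, (c m).f (z l) = some (F m l) := by
    intro m hm l hl
    obtain ⟨s, hs⟩ := exists_f ((hch m hm).step l hl)
    simp [F, hs]
  have hFu : ∀ m < r, ∀ l < m, F m l * invert (F m l) = ident := fun m hm l hl =>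
    (hc m hm).2 (z l) _ (hF m hm l hl)
  -- Both products are undefined exactly at `z j` and `z m`, and elements of `unitPart C` are
  -- determined by their domains.
  have hcomm : ∀ j m, j < m → m < r → c j * c m = c m * c (j + 1) := by
    intro j m hjm hm
    have hj := hch j (by omega)
    have hj1 := hch (j + 1) (by omega)
    have hm' := hch m hm
    refine unitPart_eq hC (Subsemigroup.mul_mem _ (hc _ (by omega)) (hc _ hm))
      (Subsemigroup.mul_mem _ (hc _ hm) (hc _ (by omega))) fun w => ?_
    rw [mul_a, mul_a, IS.mul_apply, IS.mul_apply]
    by_cases hw : ∃ l ≤ m, w = z l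
    · obtain ⟨l, hl, rfl⟩ := hw
      have hfix : ∀ i < r, ∀ p, i < p → p < r → (c i).a (z p) = some (z p) := by
        intro i hi p hip hp
        refine (hch i hi).fixed _ fun q hq h => ?_
        have := hz p hp q (by omega) h
        omega
      rcases lt_trichotomy l j with h | rfl | h
      · rw [hj.step l h, hm'.step l (by omega), Option.bind_some, Option.bind_some,
          hm'.step (l + 1) (by omega), hj1.step (l + 1) (by omega)]
      · rw [hj.last, hm'.step l hjm, Option.bind_some, hj1.last]
        rfl
      · rw [hfix j (by omega) l h (by omega), Option.bind_some]
        rcases hl.lt_or_eq with h' | rfl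
        · rw [hm'.step l h', Option.bind_some, hfix (j + 1) (by omega) _ (by omega) (by omega)]
        · rw [hm'.last]
          rfl
    · push Not at hw
      rw [hj.fixed w fun i hi => hw i (by omega), hm'.fixed w hw, Option.bind_some,
        Option.bind_some, hm'.fixed w hw, hj1.fixed w fun i hi => hw i (by omega)]
  -- The entry of `c m` at `z l` does not depend on `m > l`. For `m > l + 1`, `hcomm` at `z l` reads
  -- `F (l+1) l * F m (l+1) = F m l * F (l+2) (l+1)`. The right-hand factors agree by induction and
  -- are units.
  have hFeq : ∀ d l, l + d + 1 < r → F (l + d + 1) l = F (l + 1) l := by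
    intro d
    induction d with
    | zero => exact fun l _ => rfl
    | succ d ih =>
      intro l hl
      have h1 := congrFun (congrArg PWr.f (hcomm (l + 1) (l + (d + 1) + 1) (by omega) hl)) (z l)
      rw [mul_f_of_eq (hF _ (by omega) _ (by omega)) ((hch _ (by omega)).step l (by omega)),
        mul_f_of_eq (hF _ (by omega) _ (by omega)) ((hch _ (by omega)).step l (by omega)),
        hF _ (by omega) _ (by omega), hF _ (by omega) _ (by omega), Option.map_some,
        Option.map_some] at h1
      have h2 := ih (l + 1) (by omega)
      rw [show l + 1 + d + 1 = l + (d + 1) + 1 by omega] at h2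
      have h3 := Option.some.inj h1
      rw [h2] at h3
      have h4 := congrArg (· * invert (F (l + 1 + 1) (l + 1))) h3
      simpa [mul_assoc, hFu (l + 1 + 1) (by omega) (l + 1) (by omega)] using h4.symm
  -- Products of consecutive entries along the block. As `h 0` is the identity, the component at the
  -- first point of the block serves as the reference for all others.
  let h : ℕ → S := fun j => Nat.rec ident (fun l p => p * F (l + 1) l) j
  have hs : ∀ l, h (l + 1) = h l * F (l + 1) l := fun l => rfl
  have hu : ∀ j < r, src (h j) = ident := by
    intro j
    induction j with
    | zero => exact fun _ => src_ident
    | succ j ih => exact fun hj => src_eq_ident_mul (ih (by omega)) (hFu _ hj _ (by omega))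
  refine ⟨h, hu, fun j hj l hl => ?_, fun t ht j => ?_⟩
  · rw [hF j hj l hl, hs, ← mul_assoc, invert_mul_self_of_src (hu l (by omega)), ident_mul,
      ← hFeq (j - l - 1) l (by omega), show l + (j - l - 1) + 1 = j by omega]
  · induction j with
    | zero => exact fun _ => by simpa [h] using ht
    | succ j ih =>
      intro hj
      have := conj_mem_component hC (hc _ hj) ((hch _ hj).step j (by omega))
        (hF _ hj j (by omega)) (ih (by omega))
      simpa [hs, mul_assoc] using this

end PWr

/-- Conjugation by a unit. -/
def UnitalInverse.conj {S : Type*} [Semigroup S] [UnitalInverse S] (v : S)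
    (h : v * invert v = ident) (h' : invert v * v = ident) : S ≃* S where
  toFun u := invert v * u * v
  invFun u := v * u * invert v
  left_inv u := by
    simp only [mul_assoc, h, mul_ident]
    rw [← mul_assoc, h, ident_mul]
  right_inv u := by
    simp only [mul_assoc, h', mul_ident]
    rw [← mul_assoc, h', ident_mul]
  map_mul' a b := by
    simp only [mul_assoc]
    rw [← mul_assoc v (invert v), h, ident_mul]

/-! ### Conjugation by a tuple of units -/

namespace PWr

variable {S X : Type*} [Semigroup S] [UnitalInverse S]

theorem invert_base {H : X → S} : invert (base H) = base fun x => invert (H x) := rfl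

/-- Conjugation by a tuple of units. -/
def conjBase [Finite S] (H : X → S) (hH : ∀ x, src (H x) = ident) : PWr S X ≃* PWr S X :=
  UnitalInverse.conj (base H)
    (by
      rw [invert_base, base_mul_base]
      exact congrArg base (funext hH))
    (by
      rw [invert_base, base_mul_base]
      exact congrArg base (funext fun x => invert_mul_self_of_src (hH x)))

theorem conjBase_a [Finite S] {H : X → S} (hH : ∀ x, src (H x) = ident) (u : PWr S X) :
    (conjBase H hH u).a = u.a := by
  change (invert (base H) * u * base H).a = u.a
  rw [mul_base_a, invert_base, base_mul_a]

theorem conjBase_f [Finite S] {H : X → S} (hH : ∀ x, src (H x) = ident) {u : PWr S X} {x y : X}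
    {s : S} (hs : u.f x = some s) (hy : u.a x = some y) :
    (conjBase H hH u).f x = some (invert (H x) * s * H y) := by
  change (invert (base H) * u * base H).f x = _
  have h1 : (base (fun x => invert (H x)) * u).f x = some (invert (H x) * s) := by
    rw [base_mul_f, hs]; rfl
  rw [invert_base, mul_f_of_eq h1 (by rw [base_mul_a]; exact hy)]
  rfl

end PWr

namespace OrderedDecomposition

variable {n : ℕ} (D : OrderedDecomposition n)

/-- The `l`-th position of the `i`-th block. -/
def position (i : Fin D.k) (l : ℕ) : Fin (D.size i) :=
  -- The value beyond the end of the block is arbitrary. It only lets a block be read as a path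
  -- indexed by `ℕ`.
  if h : l < D.size i then ⟨l, h⟩ else ⟨0, D.size_pos i⟩

theorem position_val {i : Fin D.k} {l : ℕ} (h : l < D.size i) : (D.position i l : ℕ) = l := by
  rw [position, dif_pos h]

@[simp] theorem position_coe {i : Fin D.k} (p : Fin (D.size i)) : D.position i p = p :=
  Fin.ext (D.position_val p.2)

theorem isChain_blockChain (i : Fin D.k) {j : ℕ} (hj : j < D.size i) :
    IsChainMap (D.blockChain ⟨i, D.position i j⟩) j fun l => D.elt ⟨i, D.position i l⟩ where
  step l hl := by
    rw [blockChain_elt, chain_of_lt (y := D.position i (l + 1))]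
    · rfl
    · rw [Fin.lt_def, D.position_val hj, D.position_val (hl.trans hj)]
      exact hl
    · rw [D.position_val (by omega), D.position_val (hl.trans hj)]
  last := by rw [blockChain_elt, chain_self]; rfl
  fixed w hw := by
    obtain ⟨⟨i', p⟩, rfl⟩ := D.elt.surjective w
    by_cases hi : i' = i
    · subst hi
      rw [blockChain_elt, chain_of_gt]
      · rfl
      · rw [Fin.lt_def, D.position_val hj]
        by_contra hle
        exact hw p (not_lt.1 hle) (by rw [position_coe])
    · exact D.blockChain_elt_of_ne hi _ _

end OrderedDecomposition

-- The decomposition comes from the projection of `unitPart C`, and `T i` is the component at the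
-- first point of the block `M i`. The functions `h` of all blocks form a tuple `H` of units.
-- Conjugation by it sends the lifted block chains to elements of `C` and the tuples with entries in
-- the `T i` to tuples with entries in the components. Every element of the product is a tuple times
-- a lift, so the conjugated product lies in `C`; both being cross-sections, they are equal.
open PWr in
theorem IsCrossSection.exists_eq_map_srange_R {n : ℕ} {S : Type*} [Semigroup S] [UnitalInverse S]
    [Finite S] {C : Subsemigroup (PWr S (Fin n))} (hC : IsCrossSection .R C) :
    ∃ (D : OrderedDecomposition n) (T : Fin D.k → Subsemigroup S)
      (θ : PWr S (Fin n) ≃* PWr S (Fin n)), (∀ i, IsCrossSection .R (T i)) ∧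
        C = (D.productHom .R T).srange.map θ.toMulHom := by
  obtain ⟨D, hD⟩ := (isCrossSection_map_proj hC).exists_eq_symmSection_R
  have hex : ∀ q, ∃ c ∈ unitPart C, c.a = D.blockChain q := by
    intro q
    have := D.blockChain_mem_symmSection q
    rw [← hD] at this
    exact this
  choose c hc hca using hex
  have hcob := fun i => exists_coboundary hC (r := D.size i)
    (z := fun l => D.elt ⟨i, D.position i l⟩) (c := fun l => c ⟨i, D.position i l⟩)
    (fun l hl m hm h => by
      have h1 : D.position i l = D.position i m := by simpa using h
      rw [← D.position_val hl, h1, D.position_val hm])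
    (fun l _ => hc _) (fun l hl => by rw [hca]; exact D.isChain_blockChain i hl)
  choose h hu hf hT using hcob
  let H : Fin n → S := fun x => h (D.elt.symm x).1 (D.elt.symm x).2
  have hH : ∀ x, src (H x) = ident := fun x => hu _ _ (D.elt.symm x).2.2
  have hHe : ∀ i p, H (D.elt ⟨i, p⟩) = h i p := fun i p => by
    change h (D.elt.symm (D.elt ⟨i, p⟩)).1 (D.elt.symm (D.elt ⟨i, p⟩)).2 = _
    rw [Equiv.symm_apply_apply]
  let T : Fin D.k → Subsemigroup S := fun i => component C (D.elt ⟨i, D.position i 0⟩)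
  have hTc : ∀ i, IsCrossSection .R (T i) := fun i => isCrossSection_component hC _
  let θ := conjBase H hH
  -- The partial bijections whose lifts are conjugated into `C` form a subsemigroup, so the
  -- generators suffice.
  have hlift : D.symmSection .R ≤
      (C.comap θ.toMulHom).comap (⟨lift, lift_mul⟩ : IS (Fin n) →ₙ* _) := by
    refine Subsemigroup.closure_le.2 ?_
    rintro _ (rfl | ⟨⟨i, j⟩, rfl⟩)
    · change θ (lift 1) ∈ C
      have : θ (lift 1) = ident := by
        refine PWr.ext (funext fun x => ?_) (conjBase_a hH _)
        rw [conjBase_f hH (lift_f_of_eq (IS.one_apply x)) (IS.one_apply x), mul_ident,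
          invert_mul_self_of_src (hH x)]
        rfl
      rw [this]
      exact hC.ident_mem
    · change θ (lift (D.blockChain ⟨i, j⟩)) ∈ C
      have hch := D.isChain_blockChain i j.2
      rw [OrderedDecomposition.position_coe] at hch
      have : θ (lift (D.blockChain ⟨i, j⟩)) = c ⟨i, j⟩ := by
        have ha : (θ (lift (D.blockChain ⟨i, j⟩))).a = D.blockChain ⟨i, j⟩ := conjBase_a hH _
        refine PWr.ext (funext fun x => ?_) (ha.trans (hca _).symm)
        -- Along the chain the entries agree by the coboundary formula, and at its end both sides
        -- are undefined. Off the chain the points are fixed, so the unit entries there are trivial.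
        by_cases hx : ∃ l ≤ (j : ℕ), x = D.elt ⟨i, D.position i l⟩
        · obtain ⟨l, hl, rfl⟩ := hx
          rcases hl.lt_or_eq with hlt | rfl
          · have h1 := hch.step l hlt
            have h2 := hf i j j.2 l hlt
            simp only [OrderedDecomposition.position_coe] at h2
            rw [conjBase_f hH (lift_f_of_eq h1) h1, h2, hHe, hHe, mul_ident,
              D.position_val (by omega), D.position_val (by omega)]
          · have h1 := hch.last
            have h2 : ∀ u : PWr S (Fin n), u.a = D.blockChain ⟨i, j⟩ →
                u.f (D.elt ⟨i, D.position i j⟩) = none := by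
              intro u hu
              rw [← Option.not_isSome_iff_eq_none, u.dom, hu, h1]
              simp
            rw [h2 _ ha, h2 _ (hca _)]
        · push Not at hx
          have h1 := hch.fixed x hx
          have h2 : (c ⟨i, j⟩).a x = some x := by rw [hca]; exact h1
          obtain ⟨s, hs⟩ := exists_f h2
          rw [conjBase_f hH (lift_f_of_eq h1) h1, mul_ident, invert_mul_self_of_src (hH x), hs,
            eq_ident_of_fixed hC (hc _).1 h2 hs ((hc _).2 x s hs)]
      rw [this]
      exact (hc _).1
  refine ⟨D, T, θ, hTc, (IsCrossSection.eq_of_le ((D.isCrossSection_srange_R hTc).map θ) hC ?_).symm⟩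
  rintro _ ⟨u, hu, rfl⟩
  change θ u ∈ C
  obtain ⟨hu1, hu2⟩ := D.mem_srange_productHom_R.1 hu
  -- Where `u` is undefined, the value of `f` is irrelevant for the product with `lift u.a`, but it
  -- still has to lie in `T i`. The identity does.
  let f : Fin n → S := fun x => (u.f x).getD ident
  rw [← base_mul_lift (u := u) (f := f) fun x s hs => by simp [f, hs], map_mul]
  refine C.mul_mem ?_ (hlift hu2)
  have hb : θ (base f) = base fun x => invert (H x) * f x * H x := by
    refine PWr.ext (funext fun x => ?_) (conjBase_a hH _)
    rw [conjBase_f hH (u := base f) (x := x) rfl rfl]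
    rfl
  rw [hb]
  refine base_mem hC fun x => ?_
  obtain ⟨⟨i, p⟩, rfl⟩ := D.elt.surjective x
  have hfT : f (D.elt ⟨i, p⟩) ∈ T i := by
    simp only [f]
    cases hx : u.f (D.elt ⟨i, p⟩) with
    | none => exact (hTc i).ident_mem
    | some s => exact hu1 i p s hx
  have := hT i _ hfT p p.2
  simp only [OrderedDecomposition.position_coe] at this
  rwa [hHe]

theorem IsCrossSection.exists_eq_map_srange {n : ℕ} {S : Type*} [Semigroup S] [UnitalInverse S]
    [Finite S] {g : Green} {C : Subsemigroup (PWr S (Fin n))} (hC : IsCrossSection g C) :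
    ∃ (D : OrderedDecomposition n) (T : Fin D.k → Subsemigroup S)
      (θ : PWr S (Fin n) ≃* PWr S (Fin n)), (∀ i, IsCrossSection g (T i)) ∧
        C = (D.productHom g T).srange.map θ.toMulHom := by
  cases g
  · exact hC.exists_eq_map_srange_R
  · obtain ⟨D, T, θ, hT, h⟩ := (isCrossSection_L_iff.1 hC).exists_eq_map_srange_R
    -- Inversion reverses products, so conjugating `θ` by it yields an automorphism again.
    let θ' : PWr S (Fin n) ≃* PWr S (Fin n) :=
      { toFun := fun u => invert (θ (invert u))
        invFun := fun u => invert (θ.symm (invert u))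
        left_inv := fun u => by simp
        right_inv := fun u => by simp
        map_mul' := fun u v => by simp }
    refine ⟨D, fun i => inverted (T i), θ', fun i => ?_, ?_⟩
    · rw [isCrossSection_L_iff, inverted_inverted]
      exact hT i
    · have hTT : (fun i => inverted (inverted (T i))) = T := funext fun i => inverted_inverted _
      have hr : (D.productHom .L fun i => inverted (T i)).srange =
          inverted (D.productHom .R T).srange :=
        (D.srange_productHom_L _).trans
          (congrArg (fun T => inverted (D.productHom .R T).srange) hTT)
      rw [hr, ← inverted_inverted C, h]
      ext u
      constructor
      · rintro ⟨w, hw, hwu⟩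
        refine ⟨invert w, ?_, ?_⟩
        · change invert (invert w) ∈ (D.productHom .R T).srange
          rwa [invert_invert]
        · change invert (θ (invert (invert w))) = u
          rw [invert_invert, show θ w = invert u from hwu, invert_invert]
      · rintro ⟨w, hw, rfl⟩
        refine ⟨invert w, hw, ?_⟩
        change θ (invert w) = invert (invert (θ (invert w)))
        rw [invert_invert]

/-! ### Partial wreath products of isomorphic semigroups -/

theorem exists_pwr_map {S S' X : Type*} [Semigroup S] [Semigroup S'] {T : Subsemigroup S}
    {T' : Subsemigroup S'} (e : T ≃* T') {P : Subsemigroup (IS X)} (u : pwr T P) :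
    ∃ v : pwr T' P, v.1.a = u.1.a ∧
      ∀ x s (hs : s ∈ T), u.1.f x = some s → v.1.f x = some (e ⟨s, hs⟩ : S') := by
  let v : PWr S' X :=
    { f := fun x => (u.1.f x).pmap (fun s hs => (e ⟨s, hs⟩ : S')) (u.2.1 x)
      a := u.1.a
      dom := fun x => by rw [Option.isSome_pmap, u.1.dom] }
  have hv : ∀ x s (hs : s ∈ T), u.1.f x = some s → v.f x = some (e ⟨s, hs⟩ : S') := by
    intro x s hs h
    simp only [v, Option.pmap_eq_some_iff]
    exact ⟨s, hs, h, rfl⟩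
  refine ⟨⟨v, fun x t ht => ?_, u.2.2⟩, rfl, hv⟩
  obtain ⟨y, hy⟩ := PWr.exists_a ht
  obtain ⟨s, hs⟩ := PWr.exists_f (u := u.1) hy
  rw [Option.mem_def, hv x s (u.2.1 x s hs) hs] at ht
  rw [← Option.some.inj ht]
  exact (e _).2

theorem pwr_ext {S X : Type*} [Semigroup S] {T : Subsemigroup S} {P : Subsemigroup (IS X)}
    {u v : pwr T P} (ha : v.1.a = u.1.a)
    (hf : ∀ x s (_ : s ∈ T), u.1.f x = some s → v.1.f x = some s) : v = u := by
  refine Subtype.ext (PWr.ext (funext fun x => ?_) ha)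
  refine IS.eq_of_isSome (fun s hs => hf x s (u.2.1 x s hs) hs) ?_
  rw [u.1.dom, v.1.dom, ha]

/-- A partial wreath product depends only on the isomorphism type of its first factor. -/
theorem nonempty_pwr_mulEquiv {S S' X : Type*} [Semigroup S] [Semigroup S'] {T : Subsemigroup S}
    {T' : Subsemigroup S'} (e : T ≃* T') (P : Subsemigroup (IS X)) :
    Nonempty (pwr T P ≃* pwr T' P) := by
  choose φ hφ1 hφ2 using fun u : pwr T P => exists_pwr_map e u
  choose ψ hψ1 hψ2 using fun u : pwr T' P => exists_pwr_map e.symm u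
  refine ⟨{ toFun := φ, invFun := ψ, left_inv := fun u => ?_, right_inv := fun u => ?_,
            map_mul' := fun u v => ?_ }⟩
  · refine pwr_ext (by rw [hψ1, hφ1]) fun x s hs h => ?_
    rw [hψ2 _ x _ (e ⟨s, hs⟩).2 (hφ2 _ x s hs h)]
    simp
  · refine pwr_ext (by rw [hφ1, hψ1]) fun x s hs h => ?_
    rw [hφ2 _ x _ (e.symm ⟨s, hs⟩).2 (hψ2 _ x s hs h)]
    simp
  · have ha : (φ (u * v)).1.a = (φ u * φ v).1.a := by
      rw [hφ1]
      change u.1.a * v.1.a = (φ u).1.a * (φ v).1.a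
      rw [hφ1, hφ1]
    refine Subtype.ext (PWr.ext (funext fun x => ?_) ha)
    · have hsome : ((φ (u * v)).1.f x).isSome = ((φ u * φ v).1.f x).isSome := by
        rw [PWr.dom, PWr.dom, ha]
      rcases (u * v).1.cases_eq x with ⟨h, h'⟩ | ⟨s, z, h, h'⟩
      · have h1 : (φ (u * v)).1.f x = none := by
          rw [← Option.not_isSome_iff_eq_none, PWr.dom, hφ1, h']
          simp
        rw [h1] at hsome ⊢
        symm
        simpa using hsome.symm
      · obtain ⟨y, hy, hz⟩ := IS.mul_eq_some.1 (show (u.1.a * v.1.a) x = some z from h')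
        obtain ⟨p, hp⟩ := PWr.exists_f hy
        obtain ⟨q, hq⟩ := PWr.exists_f hz
        have hpT := u.2.1 x p hp
        have hqT := v.2.1 y q hq
        have h1 : (u * v).1.f x = some (p * q) := by
          change (u.1 * v.1).f x = _
          rw [PWr.mul_f_of_eq hp hy, hq]; rfl
        rw [hφ2 _ x _ (T.mul_mem hpT hqT) h1]
        change _ = ((φ u).1 * (φ v).1).f x
        rw [PWr.mul_f_of_eq (hφ2 u x p hpT hp) (by rw [hφ1]; exact hy), hφ2 v y q hqT hq]
        exact congrArg some (congrArg Subtype.val (e.map_mul ⟨p, hpT⟩ ⟨q, hqT⟩))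

theorem OrderedDecomposition.nonempty_product_mulEquiv {n : ℕ} (D : OrderedDecomposition n)
    {S : Type*} [Semigroup S] (g : Green) {T T' : Fin D.k → Subsemigroup S}
    (h : ∀ i, Nonempty (T i ≃* T' i)) : Nonempty (D.Product g T ≃* D.Product g T') :=
  ⟨MulEquiv.piCongrRight fun i =>
    (nonempty_pwr_mulEquiv (h i).some (chainSection (D.size i) g)).some⟩

theorem PWr.nonempty_mulEquiv {S S' X : Type*} [Semigroup S] [Semigroup S'] (e : S ≃* S') :
    Nonempty (PWr S X ≃* PWr S' X) := by
  refine ⟨{ toFun := fun u => ⟨fun x => (u.f x).map e, u.a, fun x => by rw [Option.isSome_map, u.dom]⟩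
            invFun := fun u =>
              ⟨fun x => (u.f x).map e.symm, u.a, fun x => by rw [Option.isSome_map, u.dom]⟩
            left_inv := fun u => PWr.ext (funext fun x => ?_) rfl
            right_inv := fun u => PWr.ext (funext fun x => ?_) rfl
            map_mul' := fun u v => PWr.ext (funext fun x => ?_) rfl }⟩
  · cases h : u.f x <;> simp [h]
  · cases h : u.f x <;> simp [h]
  · simp only [PWr.mul_f]
    rcases u.cases_eq x with ⟨h, h'⟩ | ⟨s, y, h, h'⟩
    · simp [h]
    · cases h2 : v.f y <;> simp [h, h', h2]

theorem PWr.nonempty_mulEquiv_of_subsingleton {S X : Type*} [Semigroup S] [UnitalInverse S]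
    [Subsingleton S] : Nonempty (PWr S X ≃* IS X) := by
  refine ⟨{ toFun := PWr.a, invFun := PWr.lift, left_inv := fun u => PWr.ext (funext fun x => ?_) rfl
            right_inv := fun a => rfl, map_mul' := fun u v => rfl }⟩
  rcases u.cases_eq x with ⟨h, h'⟩ | ⟨s, y, h, h'⟩
  · change (u.a x).map _ = _
    rw [h, h']; rfl
  · rw [PWr.lift_f_of_eq h', h]
    exact congrArg some (Subsingleton.elim _ _)

/-! ### Partial automorphisms as elements of a partial wreath product -/

theorem exists_partial_function {α β : Type*} (r : α → β → Prop)
    (h1 : ∀ x y y', r x y → r x y' → y = y') : ∃ f : α → Option β, ∀ x y, f x = some y ↔ r x y := by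
  have : ∀ x, ∃ o : Option β, ∀ y, o = some y ↔ r x y := by
    intro x
    by_cases h : ∃ y, r x y
    · obtain ⟨y, hy⟩ := h
      exact ⟨some y, fun y' => ⟨fun h' => Option.some.inj h' ▸ hy, fun h' => congrArg some (h1 x y y' hy h')⟩⟩
    · exact ⟨none, fun y' => ⟨fun h' => absurd h' (by simp), fun h' => absurd ⟨y', h'⟩ h⟩⟩
  choose f hf using this
  exact ⟨f, hf⟩

theorem exists_pequiv {α β : Type*} (r : α → β → Prop) (h1 : ∀ x y y', r x y → r x y' → y = y')
    (h2 : ∀ x x' y, r x y → r x' y → x = x') : ∃ a : α ≃. β, ∀ x y, a x = some y ↔ r x y := by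
  obtain ⟨f, hf⟩ := exists_partial_function r h1
  obtain ⟨f', hf'⟩ := exists_partial_function (fun y x => r x y) fun y x x' h h' => h2 x x' y h h'
  exact ⟨⟨f, f', fun x y => (hf' y x).trans (hf x y).symm⟩, hf⟩

namespace TreeVertex

variable {n k : ℕ}

/-- The vertex `w` in the subtree below the child `x` of the root. -/
def cons (x : Fin n) (w : TreeVertex n k) : TreeVertex n (k + 1) :=
  ⟨x :: w.1, Nat.succ_le_succ w.2⟩

theorem cons_inj {x y : Fin n} {w w' : TreeVertex n k} :
    cons x w = cons y w' ↔ x = y ∧ w = w' := by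
  simp [cons, Subtype.ext_iff]

theorem cons_ne_root (x : Fin n) (w : TreeVertex n k) : cons x w ≠ treeRoot n (k + 1) := by
  simp [cons, treeRoot, Subtype.ext_iff]

theorem eq_root_or_cons (v : TreeVertex n (k + 1)) :
    v = treeRoot n (k + 1) ∨ ∃ x w, v = cons x w := by
  obtain ⟨v, hv⟩ := v
  cases v with
  | nil => exact Or.inl rfl
  | cons x w => exact Or.inr ⟨x, ⟨w, Nat.le_of_succ_le_succ hv⟩, rfl⟩

instance : Finite (TreeVertex n k) := (List.finite_length_le (Fin n) k).to_subtype

end TreeVertex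

open TreeVertex

section Tree

variable {n k : ℕ}

/-- Since the root is fixed, connectedness of the domain amounts to closure under parents, and
adjacency is preserved exactly when children go to children. All later arguments thus become single
steps in the tree. -/
theorem isPartialAut_iff {φ : IS (TreeVertex n k)} :
    IsPartialAut φ ↔ φ (treeRoot n k) = some (treeRoot n k) ∧
      ∀ (u v v' : TreeVertex n k) (x : Fin n), v.1 = u.1 ++ [x] → φ v = some v' →
        ∃ u', φ u = some u' ∧ ∃ y, v'.1 = u'.1 ++ [y] := by
  constructor
  · intro h
    refine ⟨h.root, fun u v v' x hv hv' => ?_⟩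
    obtain ⟨u', hu'⟩ := Option.isSome_iff_exists.1 (h.parent_isSome (by rw [hv']; rfl) hv)
    exact ⟨u', hu', h.child _ u v u' v' x rfl hv hu' hv'⟩
  · rintro ⟨h0, h⟩
    refine ⟨h0, regularTree_connected (by simp [h0]) fun u v x hv e => ?_, ?_⟩
    · obtain ⟨v', hv'⟩ := Option.isSome_iff_exists.1 hv
      obtain ⟨u', hu', -⟩ := h u v v' x e hv'
      change (φ u).isSome
      rw [hu']; rfl
    · rintro u v u' v' hu hv (⟨x, hx⟩ | ⟨x, hx⟩)
      · obtain ⟨u'', hu'', y, hy⟩ := h u v v' x hx hv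
        rw [hu] at hu''
        cases hu''
        exact Or.inl ⟨y, hy⟩
      · obtain ⟨v'', hv'', y, hy⟩ := h v u u' x hx hu
        rw [hv] at hv''
        cases hv''
        exact Or.inr ⟨y, hy⟩

theorem exists_graft (u : PWr (PAut n k) (Fin n)) : ∃ φ : IS (TreeVertex n (k + 1)),
    φ (treeRoot n (k + 1)) = some (treeRoot n (k + 1)) ∧
    ∀ x w v, φ (cons x w) = some v ↔ ∃ s y w', u.f x = some s ∧ u.a x = some y ∧
      s.1 w = some w' ∧ v = cons y w' := by
  obtain ⟨φ, hφ⟩ := exists_pequiv (α := TreeVertex n (k + 1)) (β := TreeVertex n (k + 1))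
    (fun v v' => v = treeRoot n (k + 1) ∧ v' = treeRoot n (k + 1) ∨
      ∃ x w s y w', v = cons x w ∧ u.f x = some s ∧ u.a x = some y ∧ s.1 w = some w' ∧
        v' = cons y w')
    (by
      rintro v v' v'' (⟨rfl, rfl⟩ | ⟨x, w, s, y, w', rfl, h1, h2, h3, rfl⟩)
        (⟨h, rfl⟩ | ⟨x', w1, s', y', w1', h, h1', h2', h3', rfl⟩)
      · rfl
      · exact absurd h.symm (cons_ne_root _ _)
      · exact absurd h (cons_ne_root _ _)
      · obtain ⟨rfl, rfl⟩ := cons_inj.1 h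
        rw [h1] at h1'
        cases h1'
        rw [h2] at h2'
        cases h2'
        rw [h3] at h3'
        cases h3'
        rfl)
    (by
      rintro v v' v'' (⟨rfl, rfl⟩ | ⟨x, w, s, y, w', rfl, h1, h2, h3, rfl⟩)
        (⟨rfl, h⟩ | ⟨x', w1, s', y', w1', rfl, h1', h2', h3', h⟩)
      · rfl
      · exact absurd h.symm (cons_ne_root _ _)
      · exact absurd h (cons_ne_root _ _)
      · obtain ⟨rfl, rfl⟩ := cons_inj.1 h
        obtain rfl := u.a.inj h2 h2'
        rw [h1] at h1'
        cases h1'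
        rw [s.1.inj h3 h3'])
  refine ⟨φ, (hφ _ _).2 (Or.inl ⟨rfl, rfl⟩), fun x w v => (hφ _ _).trans ⟨?_, ?_⟩⟩
  · rintro (⟨h, -⟩ | ⟨x', w1, s, y, w', h, h1, h2, h3, rfl⟩)
    · exact absurd h (cons_ne_root _ _)
    · obtain ⟨rfl, rfl⟩ := cons_inj.1 h
      exact ⟨s, y, w', h1, h2, h3, rfl⟩
  · rintro ⟨s, y, w', h⟩
    exact Or.inr ⟨x, w, s, y, w', rfl, h⟩

/-- The partial automorphism of the tree with `k + 1` levels that acts as `u.a` on the children of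
the root and as `u.f x` below the child `x`. -/
noncomputable def graft (u : PWr (PAut n k) (Fin n)) : IS (TreeVertex n (k + 1)) :=
  (exists_graft u).choose

theorem graft_root (u : PWr (PAut n k) (Fin n)) :
    graft u (treeRoot n (k + 1)) = some (treeRoot n (k + 1)) := (exists_graft u).choose_spec.1

theorem graft_cons {u : PWr (PAut n k) (Fin n)} {x : Fin n} {w : TreeVertex n k}
    {v : TreeVertex n (k + 1)} :
    graft u (cons x w) = some v ↔ ∃ s y w', u.f x = some s ∧ u.a x = some y ∧
      s.1 w = some w' ∧ v = cons y w' := (exists_graft u).choose_spec.2 x w v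

theorem isPartialAut_graft (u : PWr (PAut n k) (Fin n)) : IsPartialAut (graft u) := by
  refine isPartialAut_iff.2 ⟨graft_root u, fun p v v' x hv hv' => ?_⟩
  rcases eq_root_or_cons p with rfl | ⟨z, w, rfl⟩
  · obtain rfl : v = cons x (treeRoot n k) := Subtype.ext hv
    obtain ⟨s, y, w', -, -, h3, rfl⟩ := graft_cons.1 hv'
    rw [s.2.root] at h3
    cases h3
    exact ⟨_, graft_root u, y, rfl⟩
  · rcases eq_root_or_cons v with rfl | ⟨z', w1, rfl⟩
    · simp [treeRoot, cons] at hv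
    · obtain ⟨rfl, hw⟩ : z' = z ∧ w1.1 = w.1 ++ [x] := by simpa [cons] using hv
      obtain ⟨s, y, w', h1, h2, h3, rfl⟩ := graft_cons.1 hv'
      obtain ⟨w2, h4, y', hy'⟩ := (isPartialAut_iff.1 s.2).2 w w1 w' x hw h3
      exact ⟨cons y w2, graft_cons.2 ⟨s, y, w2, h1, h2, h4, rfl⟩, y', by simp [cons, hy']⟩

theorem graft_mul (u v : PWr (PAut n k) (Fin n)) : graft (u * v) = graft u * graft v := by
  refine PEquiv.ext fun p => ?_
  rcases eq_root_or_cons p with rfl | ⟨x, w, rfl⟩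
  · rw [graft_root, IS.mul_apply, graft_root, Option.bind_some, graft_root]
  · refine Option.ext fun q => ?_
    rw [graft_cons, IS.mul_eq_some]
    constructor
    · rintro ⟨s, z, w', h1, h2, h3, rfl⟩
      obtain ⟨y, hy, hz⟩ := IS.mul_eq_some.1 (show (u.a * v.a) x = some z from h2)
      obtain ⟨p, hp⟩ := PWr.exists_f hy
      obtain ⟨q, hq⟩ := PWr.exists_f hz
      rw [PWr.mul_f_of_eq hp hy, hq] at h1
      cases h1
      obtain ⟨w1, h4, h5⟩ := IS.mul_eq_some.1 (show (p.1 * q.1) w = some w' from h3)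
      exact ⟨cons y w1, graft_cons.2 ⟨p, y, w1, hp, hy, h4, rfl⟩,
        graft_cons.2 ⟨q, z, w', hq, hz, h5, rfl⟩⟩
    · rintro ⟨r, h1, h2⟩
      obtain ⟨p, y, w1, hp, hy, h4, rfl⟩ := graft_cons.1 h1
      obtain ⟨q, z, w', hq, hz, h5, rfl⟩ := graft_cons.1 h2
      refine ⟨p * q, z, w', ?_, IS.mul_eq_some.2 ⟨y, hy, hz⟩, IS.mul_eq_some.2 ⟨w1, h4, h5⟩, rfl⟩
      rw [PWr.mul_f_of_eq hp hy, hq]; rfl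

/-- Each entry of `u` is a partial automorphism and so defined at the root. Hence the image of the
first-level vertex `x` alone reveals whether `x` lies in the domain and what `u.a x` is, and the
entry can then be read off below `x`. -/
theorem graft_injective : Function.Injective (graft : PWr (PAut n k) (Fin n) → _) := by
  have key : ∀ {u v : PWr (PAut n k) (Fin n)}, graft u = graft v → ∀ x s y, u.f x = some s →
      u.a x = some y → v.a x = some y ∧ v.f x = some s := by
    intro u v h x s y hs hy
    have h1 : ∀ w w', s.1 w = some w' → ∃ t, v.f x = some t ∧ v.a x = some y ∧ t.1 w = some w' := by
      intro w w' hw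
      have := graft_cons.2 ⟨s, y, w', hs, hy, hw, rfl⟩
      rw [h] at this
      obtain ⟨t, y', w'', h1, h2, h3, h4⟩ := graft_cons.1 this
      obtain ⟨rfl, rfl⟩ := cons_inj.1 h4
      exact ⟨t, h1, h2, h3⟩
    obtain ⟨t, ht, hy', -⟩ := h1 _ _ s.2.root
    refine ⟨hy', ?_⟩
    rw [ht]
    congr 1
    refine Subtype.ext (PEquiv.ext fun w => Option.ext fun w' => ⟨fun hw => ?_, fun hw => ?_⟩)
    · have := graft_cons.2 ⟨t, y, w', ht, hy', hw, rfl⟩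
      rw [← h] at this
      obtain ⟨s', y', w'', h1, h2, h3, h4⟩ := graft_cons.1 this
      rw [hs] at h1
      cases h1
      obtain ⟨rfl, rfl⟩ := cons_inj.1 h4
      exact h3
    · obtain ⟨t', ht', -, h'⟩ := h1 w w' hw
      rw [ht] at ht'
      cases ht'
      exact h'
  intro u v h
  refine PWr.ext (funext fun x => Option.ext fun s => ⟨fun hs => ?_, fun hs => ?_⟩)
    (PEquiv.ext fun x => Option.ext fun y => ⟨fun hy => ?_, fun hy => ?_⟩)
  · obtain ⟨y, hy⟩ := PWr.exists_a hs
    exact (key h x s y hs hy).2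
  · obtain ⟨y, hy⟩ := PWr.exists_a hs
    exact (key h.symm x s y hs hy).2
  · obtain ⟨s, hs⟩ := PWr.exists_f hy
    exact (key h x s y hs hy).1
  · obtain ⟨s, hs⟩ := PWr.exists_f hy
    exact (key h.symm x s y hs hy).1

/-- Walking down from `x`, children go to children of the image, so everything below `x` stays below
one first-level vertex. -/
theorem IsPartialAut.exists_cons {φ : IS (TreeVertex n (k + 1))} (h : IsPartialAut φ) (x : Fin n)
    (w : TreeVertex n k) {v : TreeVertex n (k + 1)} (hv : φ (cons x w) = some v) :
    ∃ y w', φ (cons x (treeRoot n k)) = some (cons y (treeRoot n k)) ∧ v = cons y w' := by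
  rw [isPartialAut_iff] at h
  obtain ⟨w, hw⟩ := w
  induction w using List.reverseRecOn generalizing v with
  | nil =>
    obtain ⟨u', hu', y, hy⟩ := h.2 (treeRoot n (k + 1)) _ v x rfl hv
    rw [h.1] at hu'
    cases hu'
    obtain rfl : v = cons y (treeRoot n k) := Subtype.ext hy
    exact ⟨y, _, hv, rfl⟩
  | append_singleton w z ih =>
    have hw' : w.length ≤ k := by simp at hw; omega
    obtain ⟨u', hu', z', hz'⟩ := h.2 (cons x ⟨w, hw'⟩) _ v z rfl hv
    obtain ⟨y, w', h1, rfl⟩ := ih hw' hu'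
    rcases eq_root_or_cons v with rfl | ⟨y', w'', rfl⟩
    · simp [treeRoot, cons] at hz'
    · obtain ⟨rfl, -⟩ : y' = y ∧ _ := by simpa [cons] using hz'
      exact ⟨y', w'', h1, rfl⟩

/-- The second coordinate is the action on the first level. By `IsPartialAut.exists_cons` the
subtree below `x` goes into the subtree below the image of `x`, which defines the entry at `x`. -/
theorem exists_graft_eq {φ : IS (TreeVertex n (k + 1))} (h : IsPartialAut φ) :
    ∃ u : PWr (PAut n k) (Fin n), graft u = φ := by
  obtain ⟨a, ha⟩ := exists_pequiv
    (fun x y : Fin n => φ (cons x (treeRoot n k)) = some (cons y (treeRoot n k)))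
    (fun x y y' h1 h2 => by
      rw [h1] at h2
      exact (cons_inj.1 (Option.some.inj h2)).1)
    (fun x x' y h1 h2 => (cons_inj.1 (φ.inj h1 h2)).1)
  have hex : ∀ x, ∃ o : Option (PAut n k), o.isSome = (a x).isSome ∧ ∀ s, o = some s →
      ∀ y, a x = some y → ∀ w w', s.1 w = some w' ↔ φ (cons x w) = some (cons y w') := by
    intro x
    cases hx : a x with
    | none => exact ⟨none, rfl, fun s hs => by cases hs⟩
    | some y =>
      obtain ⟨s, hs⟩ := exists_pequiv
        (fun w w' : TreeVertex n k => φ (cons x w) = some (cons y w'))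
        (fun w w' w'' h1 h2 => by
          rw [h1] at h2
          exact (cons_inj.1 (Option.some.inj h2)).2)
        (fun w w' w'' h1 h2 => (cons_inj.1 (φ.inj h1 h2)).2)
      have hsA : IsPartialAut s := by
        refine isPartialAut_iff.2 ⟨(hs _ _).2 ((ha _ _).1 hx), fun p q q' z hq hq' => ?_⟩
        obtain ⟨u', hu', z', hz'⟩ := (isPartialAut_iff.1 h).2 (cons x p) (cons x q) (cons y q') z
          (by simp [cons, hq]) ((hs _ _).1 hq')
        obtain ⟨y', p', h1, rfl⟩ := h.exists_cons x p hu'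
        obtain ⟨rfl, hp'⟩ : y = y' ∧ q'.1 = p'.1 ++ [z'] := by simpa [cons] using hz'
        exact ⟨p', (hs _ _).2 hu', z', hp'⟩
      refine ⟨some ⟨s, hsA⟩, rfl, ?_⟩
      intro s' hs' y' hy'
      cases hs'
      cases hy'
      exact hs
  choose f hf1 hf2 using hex
  refine ⟨⟨f, a, hf1⟩, PEquiv.ext fun p => ?_⟩
  rcases eq_root_or_cons p with rfl | ⟨x, w, rfl⟩
  · rw [graft_root, h.root]
  · refine Option.ext fun v => ?_
    rw [graft_cons]
    constructor
    · rintro ⟨s, y, w', h1, h2, h3, rfl⟩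
      exact (hf2 x s h1 y h2 w w').1 h3
    · intro hv
      obtain ⟨y, w', h1, rfl⟩ := h.exists_cons x w hv
      have h2 : a x = some y := (ha x y).2 h1
      obtain ⟨s, hs⟩ := Option.isSome_iff_exists.1 ((hf1 x).trans (by rw [h2]; rfl))
      exact ⟨s, y, w', hs, h2, (hf2 x s hs y h2 w w').2 hv, rfl⟩

theorem nonempty_PAut_succ_mulEquiv (n k : ℕ) :
    Nonempty (PAut n (k + 1) ≃* PWr (PAut n k) (Fin n)) := by
  let e : PWr (PAut n k) (Fin n) →ₙ* PAut n (k + 1) :=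
    { toFun := fun u => ⟨graft u, isPartialAut_graft u⟩
      map_mul' := fun u v => Subtype.ext (graft_mul u v) }
  refine ⟨(MulEquiv.ofBijective e ⟨fun u v h => graft_injective (congrArg Subtype.val h),
    fun φ => ?_⟩).symm⟩
  obtain ⟨u, hu⟩ := exists_graft_eq φ.2
  exact ⟨u, Subtype.ext hu⟩

theorem PAut_zero_eq_one {φ : IS (TreeVertex n 0)} (h : IsPartialAut φ) : φ = 1 := by
  refine PEquiv.ext fun v => ?_
  obtain rfl : v = treeRoot n 0 := Subtype.ext (List.length_eq_zero_iff.1 (Nat.le_zero.1 v.2))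
  rw [h.root]
  rfl

instance : Subsingleton (PAut n 0) :=
  ⟨fun φ ψ => Subtype.ext ((PAut_zero_eq_one φ.2).trans (PAut_zero_eq_one ψ.2).symm)⟩

theorem one_mem_PAut : 1 ∈ PAut n k :=
  isPartialAut_iff.2 ⟨rfl, fun u v v' x hv h => ⟨u, rfl, x, by cases h; exact hv⟩⟩

/-- The recursion starts at the tree without levels, whose only partial automorphism is the
identity; a wreath product over a trivial semigroup is just `IS n`. The index is shifted because
`IterWr n k` has `k + 1` factors. -/
theorem nonempty_PAut_mulEquiv (n : ℕ) : ∀ k, Nonempty (PAut n (k + 1) ≃* IterWr n k)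
  | 0 => by
    let i : UnitalInverse (PAut n 0) :=
      { ident := ⟨1, one_mem_PAut⟩
        invert := id
        ident_mul := fun _ => Subsingleton.elim _ _
        mul_ident := fun _ => Subsingleton.elim _ _
        invert_invert := fun _ => Subsingleton.elim _ _
        invert_mul := fun _ _ => Subsingleton.elim _ _
        mul_invert_mul := fun _ => Subsingleton.elim _ _
        mul_invert_comm := fun _ _ => Subsingleton.elim _ _ }
    exact ⟨(nonempty_PAut_succ_mulEquiv n 0).some.trans
      (PWr.nonempty_mulEquiv_of_subsingleton (S := PAut n 0) (X := Fin n)).some⟩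
  | k + 1 => ⟨(nonempty_PAut_succ_mulEquiv n (k + 1)).some.trans
      (PWr.nonempty_mulEquiv (X := Fin n) (nonempty_PAut_mulEquiv n k).some).some⟩

end Tree

/-! ### Cross-sections of iterated partial wreath products -/

instance IterWr.instUnitalInverse (n : ℕ) : ∀ k, UnitalInverse (IterWr n k)
  | 0 => inferInstanceAs (UnitalInverse (IS (Fin n)))
  | k + 1 =>
    letI := IterWr.instUnitalInverse n k
    inferInstanceAs (UnitalInverse (PWr (IterWr n k) (Fin n)))

instance IterWr.instFinite (n : ℕ) : ∀ k, Finite (IterWr n k)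
  | 0 => inferInstanceAs (Finite (IS (Fin n)))
  | k + 1 =>
    have := IterWr.instFinite n k
    inferInstanceAs (Finite (PWr (IterWr n k) (Fin n)))

theorem isCrossSection_iterSection (n : ℕ) (g : Green) :
    ∀ k (c : IterData n k), IsCrossSection g (iterSection n g k c)
  | 0, D => OrderedDecomposition.isCrossSection_symmSection D g
  | k + 1, ⟨D, c⟩ => D.isCrossSection_srange fun i => isCrossSection_iterSection n g k (c i)

theorem IsCrossSection.exists_mulEquiv_product {n : ℕ} {S : Type*} [Semigroup S] [UnitalInverse S]
    [Finite S] {g : Green} {C : Subsemigroup (PWr S (Fin n))} (hC : IsCrossSection g C) :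
    ∃ (D : OrderedDecomposition n) (T : Fin D.k → Subsemigroup S),
      (∀ i, IsCrossSection g (T i)) ∧ Nonempty (C ≃* D.Product g T) := by
  obtain ⟨D, T, θ, hT, rfl⟩ := hC.exists_eq_map_srange
  exact ⟨D, T, hT, ⟨(nonempty_mulEquiv_map θ _).some.symm.trans (D.nonempty_srange_mulEquiv g T).some⟩⟩

/-- The induction step for iterated products. The factors `T i` may be replaced by isomorphic
models, as a product depends on them only up to isomorphism; the price is that `C` is recovered up
to isomorphism and not as a subset. -/
theorem IsCrossSection.exists_mulEquiv_srange {n : ℕ} {S : Type*} [Semigroup S] [UnitalInverse S]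
    [Finite S] {g : Green} {C : Subsemigroup (PWr S (Fin n))} (hC : IsCrossSection g C)
    {ι : Type*} {Q : ι → Subsemigroup S}
    (hQ : ∀ T : Subsemigroup S, IsCrossSection g T → ∃ c, Nonempty (T ≃* Q c)) :
    ∃ (D : OrderedDecomposition n) (c : Fin D.k → ι),
      Nonempty (C ≃* (D.productHom g fun i => Q (c i)).srange) := by
  obtain ⟨D, T, hT, ⟨e⟩⟩ := hC.exists_mulEquiv_product
  choose c hc using fun i => hQ (T i) (hT i)
  exact ⟨D, c, ⟨e.trans ((D.nonempty_product_mulEquiv g hc).some.trans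
    (D.nonempty_srange_mulEquiv g _).some.symm)⟩⟩

theorem IsCrossSection.exists_mulEquiv_iterSection {n : ℕ} {g : Green} :
    ∀ {k} {C : Subsemigroup (IterWr n k)}, IsCrossSection g C →
      ∃ c : IterData n k, Nonempty (C ≃* iterSection n g k c)
  | 0, C, hC => by
    obtain ⟨D, hD⟩ := IsCrossSection.exists_eq_symmSection (n := n) (C := C) hC
    obtain rfl : C = iterSection n g 0 D := hD
    exact ⟨D, ⟨MulEquiv.refl _⟩⟩
  | k + 1, C, hC => by
    obtain ⟨D, c, h⟩ := IsCrossSection.exists_mulEquiv_srange (S := IterWr n k) (C := C) hC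
      (Q := iterSection n g k) fun T hT => hT.exists_mulEquiv_iterSection
    exact ⟨⟨D, c⟩, h⟩

/-- Cross-sections refer to the multiplication only, so it does not matter which isomorphism
transports the inverse structure. -/
noncomputable instance PAut.instUnitalInverse (n k : ℕ) : UnitalInverse (PAut n (k + 1)) :=
  UnitalInverse.ofMulEquiv (nonempty_PAut_mulEquiv n k).some

/-! ### The main theorem -/

theorem mainTheorem2 (n : ℕ) (g : Green) :
    -- The semigroup `IS n ≀ IS n`.
    (∀ (D : OrderedDecomposition n) (T : Fin D.k → Subsemigroup (IS (Fin n))),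
      (∀ i, IsCrossSection g (T i)) →
        Function.Injective (D.productHom g T) ∧ IsCrossSection g (D.productHom g T).srange) ∧
    (∀ C : Subsemigroup (PWr (IS (Fin n)) (Fin n)), IsCrossSection g C →
      ∃ (D : OrderedDecomposition n) (T : Fin D.k → Subsemigroup (IS (Fin n))),
        (∀ i, IsCrossSection g (T i)) ∧ Nonempty (C ≃* D.Product g T)) ∧
    -- The semigroup of partial automorphisms of the tree with `k + 1` levels, identified with
    -- the partial wreath product of `k + 1` copies of `IS n`.
    (∀ k, Nonempty (PAut n (k + 1) ≃* IterWr n k)) ∧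
    -- One more level: the cross-sections for `k + 2` levels in terms of those for `k + 1` levels.
    (∀ k, Nonempty (PAut n (k + 2) ≃* PWr (PAut n (k + 1)) (Fin n))) ∧
    (∀ k, ∀ e : PAut n (k + 2) ≃* PWr (PAut n (k + 1)) (Fin n),
      ∀ (D : OrderedDecomposition n) (T : Fin D.k → Subsemigroup (PAut n (k + 1))),
        (∀ i, IsCrossSection g (T i)) →
          Function.Injective (D.productHom g T) ∧
            IsCrossSection g ((D.productHom g T).srange.comap e.toMulHom)) ∧
    (∀ k, ∀ C : Subsemigroup (PAut n (k + 2)), IsCrossSection g C →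
      ∃ (D : OrderedDecomposition n) (T : Fin D.k → Subsemigroup (PAut n (k + 1))),
        (∀ i, IsCrossSection g (T i)) ∧ Nonempty (C ≃* D.Product g T)) ∧
    -- All levels at once: the iterated products.
    (∀ k, ∀ e : PAut n (k + 1) ≃* IterWr n k, ∀ c : IterData n k,
      IsCrossSection g ((iterSection n g k c).comap e.toMulHom)) ∧
    (∀ k, ∀ C : Subsemigroup (PAut n (k + 1)), IsCrossSection g C →
      ∃ c : IterData n k, Nonempty (C ≃* iterSection n g k c)) := by
  refine ⟨fun D T hT => ⟨D.productHom_injective g T, D.isCrossSection_srange hT⟩,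
    fun C hC => hC.exists_mulEquiv_product, nonempty_PAut_mulEquiv n,
    fun k => nonempty_PAut_succ_mulEquiv n (k + 1),
    fun k e D T hT => ⟨D.productHom_injective g T, (D.isCrossSection_srange hT).comap e⟩,
    fun k C hC => ?_, fun k e c => (isCrossSection_iterSection n g k c).comap e, fun k C hC => ?_⟩
  · obtain ⟨e⟩ := nonempty_PAut_succ_mulEquiv n (k + 1)
    obtain ⟨D, T, hT, ⟨φ⟩⟩ := (hC.map e).exists_mulEquiv_product
    exact ⟨D, T, hT, ⟨(nonempty_mulEquiv_map e C).some.trans φ⟩⟩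
  · obtain ⟨e⟩ := nonempty_PAut_mulEquiv n k
    obtain ⟨c, ⟨φ⟩⟩ := (hC.map e).exists_mulEquiv_iterSection
    exact ⟨c, ⟨(nonempty_mulEquiv_map e C).some.trans φ⟩⟩
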